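/- Fix $L,\Lambda,\mu>0$ and let $A(z)=-\tfrac12\Lambda^2z^2+\log(L/z)$, $z>0$, be the warp factor of the five-dimensional (toy IHQCD) background with metric $e^{2A(z)}(dz^2+dx_idx^i)$. For Euclidean momentum $p\in\mathbb R^4$, let $E(z)$ be the response function of transverse-traceless metric fluctuations, that is, the solution on $0<z<\infty$ of the Riccati equation $$E'-e^{A}E^2+4A'E+p^2e^{-A}=0$$ that is regular in the infrared, meaning that $-\int^{z}e^{A}E\,dz'$ stays bounded above as $z\to\infty$. The renormalized response function $\hat E_{(4)}(p)$ is defined by the expansion, as $z\to0^+$, $$L E(z)=\tfrac12p^2L^2e^{-2A(z)}+\tfrac14p^2\left(\tfrac12p^2+3\Lambda^2\right)z^4\log(z^2\mu^2)+z^4\,L\hat E_{(4)}(p)+o(z^4).$$ Changing it by finite local counterterms means adding to $L\hat E_{(4)}(p)$ a polynomial $Q(p^2)$ with real coefficients. Let $K_1$ be the modified Bessel function of the second kind. Then $\hat E_{(4)}(p)$ exists, is unique and depends only on $p^2$ (and on $L,\Lambda,\mu$), and for every real polynomial $Q$, up to contact terms, $$\int_{\mathbb R^4} d^4p\;e^{ip\cdot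 x}\left(L\hat E_{(4)}(p)+Q(p^2)\right)=F_\Lambda(|x|),\qquad F_\Lambda(x):=-\frac{\pi^2}{2}(6\Lambda^2)^4\sum_{n=0}^\infty(n+1)(n+2)^2\,\frac{K_1\left(\sqrt{6(n+2)}\,\Lambda x\right)}{\sqrt{6(n+2)}\,\Lambda x}.$$ The series converges for every $x>0$. The equality is one of distributions on $\mathbb R^4\setminus\{0\}$: for every smooth $f:\mathbb R^4\to\mathbb C$ with compact support not containing the origin, $$\int_{\mathbb R^4} d^4p\,\left(L\hat E_{(4)}(p)+Q(p^2)\right)\int_{\mathbb R^4} d^4x\,e^{ip\cdot x}f(x)=\int_{\mathbb R^4} d^4x\,F_\Lambda(|x|)f(x),$$ where the integrals over $p$ and over $x$ converge absolutely. Moreover, as $\Lambda x\to\infty$ (with relative error tending to $0$ uniformly in $\Lambda$ at given $\Lambda x$), $$F_\Lambda(x)\sim-2\pi^2(6\Lambda^2)^4\sqrt{\frac{\pi}{2}}\;\frac{e^{-2\sqrt3\,\Lambda x}}{(2\sqrt3\,\Lambda x)^{3/2}}.$$ -/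

import Mathlib

noncomputable section

open Set Filter Topology MeasureTheory
open scoped ContDiff

namespace IHQCD

/-- The modified Bessel function of the second kind `K_ν(x)`, for `x > 0`, through its standard
integral representation `K_ν(x) = ∫₀^∞ exp (-x cosh t) cosh (ν t) dt`. -/
def besselK (ν x : ℝ) : ℝ :=
  ∫ t in Ioi (0 : ℝ), Real.exp (-(x * Real.cosh t)) * Real.cosh (ν * t)

/-- The warp factor `A(z) = -Λ² z² / 2 + log (L / z)` of the five-dimensional background metric
`exp (2 A(z)) (dz² + dx²)`, where `z > 0` is the conformal radial coordinate. The boundary (UV) is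
at `z = 0`, the infrared is `z → ∞`. -/
def warp (L Λ z : ℝ) : ℝ := -(Λ ^ 2 * z ^ 2) / 2 + Real.log (L / z)

/-- The Riccati equation `E' - e^A E² + d A' E + p² e^{-A} = 0` on `0 < z < ∞` for the response
function `E` of transverse traceless fluctuations, with `d = 4`; `s` stands for `p²`. -/
def IsResponse (L Λ s : ℝ) (E : ℝ → ℝ) : Prop :=
  ∀ z : ℝ, 0 < z →
    DifferentiableAt ℝ E z ∧
    deriv E z - Real.exp (warp L Λ z) * E z ^ 2 + 4 * deriv (warp L Λ) z * E z
      + s * Real.exp (-warp L Λ z) = 0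

/-- Infrared regularity: `∫^r E dr = -∫^z e^A E dz` stays below `+∞` in the infrared `z → ∞`, i.e.
the tensor fluctuation `exp (∫^r E dr)` with response function `E` stays bounded there. -/
def IsIRRegular (L Λ : ℝ) (E : ℝ → ℝ) : Prop :=
  ∃ z₀ : ℝ, 0 < z₀ ∧ ∃ C : ℝ, ∀ z : ℝ, z₀ ≤ z →
    -(∫ t in z₀..z, Real.exp (warp L Λ t) * E t) ≤ C

/-- The local terms of the UV expansion of `L E`, up to and including order `z⁴ log z`:
`(p² L² / 2) e^{-2A} + (p² / 4) (p² / 2 + 3 Λ²) z⁴ log (z² μ²)`; `s` stands for `p²`. -/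
def uvLocal (L Λ μ s z : ℝ) : ℝ :=
  s * L ^ 2 / 2 * Real.exp (-2 * warp L Λ z)
    + s / 4 * (s / 2 + 3 * Λ ^ 2) * z ^ 4 * Real.log (z ^ 2 * μ ^ 2)

/-- `e` is the renormalized response function `Ê₍₄₎(p)` at `p² = s`: for an infrared regular
response function `E` one has `L E = uvLocal + z⁴ L e + o(z⁴)` as `z → 0⁺`. -/
def IsRenormalizedResponse (L Λ μ s e : ℝ) : Prop :=
  ∃ E : ℝ → ℝ, IsResponse L Λ s E ∧ IsIRRegular L Λ E ∧
    Tendsto (fun z : ℝ => (L * E z - uvLocal L Λ μ s z) / z ^ 4) (𝓝[>] 0) (𝓝 (L * e))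

/-- The `n`-th term `(n + 1) (n + 2)² K₁(√(6 (n + 2)) Λ x) / (√(6 (n + 2)) Λ x)`. -/
def seriesTerm (Λ x : ℝ) (n : ℕ) : ℝ :=
  ((n : ℝ) + 1) * ((n : ℝ) + 2) ^ 2 *
    (besselK 1 (Real.sqrt (6 * ((n : ℝ) + 2)) * Λ * x) /
      (Real.sqrt (6 * ((n : ℝ) + 2)) * Λ * x))

/-- The position space function
`-(π² / 2) (6 Λ²)⁴ ∑ₙ (n + 1) (n + 2)² K₁(√(6 (n + 2)) Λ x) / (√(6 (n + 2)) Λ x)`. -/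
def positionSpace (Λ x : ℝ) : ℝ :=
  -(Real.pi ^ 2 / 2) * (6 * Λ ^ 2) ^ 4 * ∑' n : ℕ, seriesTerm Λ x n

/-- The leading large distance form
`-2 π² (6 Λ²)⁴ √(π / 2) exp (-2 √3 Λ x) / (2 √3 Λ x)^(3/2)`. -/
def largeDistance (Λ x : ℝ) : ℝ :=
  -2 * Real.pi ^ 2 * (6 * Λ ^ 2) ^ 4 * Real.sqrt (Real.pi / 2) *
    (Real.exp (-(2 * Real.sqrt 3 * Λ * x)) / (2 * Real.sqrt 3 * Λ * x) ^ (3 / 2 : ℝ))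

/-- Euclidean four-dimensional space (both position and momentum space). -/
abbrev R4 : Type := EuclideanSpace ℝ (Fin 4)

/-- `∫ d⁴p e^{i p·x} g(p²) = F(|x|)` up to contact terms, i.e. as an equality of distributions on
`ℝ⁴ \ {0}`: it holds against every smooth test function whose compact support does not contain the
origin (all integrals in it being absolutely convergent). Two distributions on `ℝ⁴` that agree there
differ by a distribution supported at `x = 0`. -/
def FourierEqUpToContact (g F : ℝ → ℝ) : Prop :=
  ∀ f : R4 → ℂ, ContDiff ℝ ∞ f → HasCompactSupport f → (0 : R4) ∉ tsupport f →
    Integrable (fun p : R4 => (g (‖p‖ ^ 2) : ℂ) *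
      ∫ x : R4, Complex.exp (Complex.I * ((inner ℝ p x : ℝ) : ℂ)) * f x) ∧
    Integrable (fun x : R4 => (F ‖x‖ : ℂ) * f x) ∧
    (∫ p : R4, (g (‖p‖ ^ 2) : ℂ) *
      ∫ x : R4, Complex.exp (Complex.I * ((inner ℝ p x : ℝ) : ℂ)) * f x)
      = ∫ x : R4, (F ‖x‖ : ℂ) * f x

end IHQCD

end

noncomputable section

open Set Filter Topology MeasureTheory
open scoped ContDiff

namespace IHQCD

/-! The Riccati equation linearises: if `h = exp(-∫ e^A E)`, then `h'' + 3A'h' - p²h = 0`. With `u =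
3Λ²z²/2` and `a = p²/(6Λ²)` this becomes the Kummer equation `u y'' - (1 + u) y' - a y = 0`. The
infrared regular solution `y = kummerN a` satisfies `y' = -a · kummerJ a`, where `kummerJ a` is the
Laplace transform of `t^a (1 + t)^(-a-2)`. Hence `E` is an explicit factor times `kummerR = kummerJ
/ kummerN`. A Wronskian argument shows that no other response function is infrared regular
(`IsResponse.eq_response`).

As `u → 0`, everything reduces to the logarithmic divergence of `kummerI`. Comparison with `∫
e^{-ut}/(1 + t) dt` leaves the harmonic number `H_{a+1} = ∑ (1/(n+1) - 1/(n+a+2))` as the only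
non-polynomial dependence on `a` (`tendsto_kummerR`). So `L Ê` is a polynomial in `p²` plus `p² (p²
+ 6Λ²) H_{a+1} / 8` (`mul_renormalizedResponse`).

Each term of the harmonic series gives a polynomial minus a multiple of the propagator `1/(p² +
m_n²)`, with `m_n² = 6Λ²(n + 2)` (`spectral_decomposition`). Polynomials integrate to zero against
the transform of a function vanishing near the origin. Propagators give `K₁` by writing them as
integrals of Gaussians. The polynomials must stay inside the terms until after the exchange of sum
and integral, because the full terms are `O(1/n²)` while their two pieces are not summable
separately.

The large distance form is the `n = 0` term: all later terms decay with a rate of at least `√18 Λ >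
2√3 Λ`, and the normalised sum depends on `Λx` only. -/

/-! ### Laplace transforms on the half line. -/

/-- The Laplace transform of `g` on the half line. -/
def laplace (g : ℝ → ℝ) (u : ℝ) : ℝ := ∫ t in Ioi (0 : ℝ), Real.exp (-(u * t)) * g t

/-- The map `t ↦ t / (1 + t)` from the half line to the unit interval. -/
def ratio (t : ℝ) : ℝ := t / (1 + t)

lemma ratio_pos {t : ℝ} (ht : 0 < t) : 0 < ratio t := by unfold ratio; positivity

lemma ratio_lt_one {t : ℝ} (ht : 0 < t) : ratio t < 1 := by
  unfold ratio; rw [div_lt_one (by linarith)]; linarith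

lemma one_sub_ratio {t : ℝ} (ht : 0 < t) : 1 - ratio t = 1 / (1 + t) := by
  unfold ratio; field_simp; ring

lemma hasDerivAt_ratio {t : ℝ} (ht : 0 < t) : HasDerivAt ratio (1 / (1 + t) ^ 2) t := by
  have h := (hasDerivAt_id t).div ((hasDerivAt_id t).const_add 1) (by simp; linarith)
  convert! h using 1
  simp

lemma continuousOn_ratio : ContinuousOn ratio (Ioi 0) :=
  fun _ ht => (hasDerivAt_ratio ht).continuousAt.continuousWithinAt

lemma ratio_rpow_le_one {t a : ℝ} (ht : 0 < t) (ha : 0 ≤ a) : ratio t ^ a ≤ 1 :=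
  Real.rpow_le_one (ratio_pos ht).le (ratio_lt_one ht).le ha

lemma ratio_rpow_nonneg {t a : ℝ} (ht : 0 < t) : 0 ≤ ratio t ^ a :=
  Real.rpow_nonneg (ratio_pos ht).le a

lemma continuousOn_ratio_rpow (a : ℝ) : ContinuousOn (fun t => ratio t ^ a) (Ioi 0) :=
  continuousOn_ratio.rpow_const fun _ ht => Or.inl (ratio_pos ht).ne'

/-- Bernoulli's inequality for `(1 - 1/(1 + t))^(a+1)`. It supplies the extra decay at large `t`
that makes the limits `u → 0` finite. -/
lemma one_sub_ratio_rpow_le {t a : ℝ} (ht : 0 < t) (ha : 0 ≤ a) :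
    1 - ratio t ^ (a + 1) ≤ (a + 1) / (1 + t) := by
  have h := one_add_mul_self_le_rpow_one_add (s := ratio t - 1) (by linarith [ratio_pos ht])
    (p := a + 1) (by linarith)
  have h2 := one_sub_ratio ht
  rw [add_sub_cancel, show ratio t - 1 = -(1 / (1 + t)) by linarith] at h
  have : (a + 1) * -(1 / (1 + t)) = -((a + 1) / (1 + t)) := by ring
  linarith

lemma tendsto_ratio_atTop : Tendsto ratio atTop (𝓝 1) := by
  have h : Tendsto (fun t : ℝ => 1 - (1 + t)⁻¹) atTop (𝓝 (1 - 0)) :=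
    tendsto_const_nhds.sub
      (tendsto_inv_atTop_zero.comp (tendsto_atTop_add_const_left _ 1 tendsto_id))
  rw [sub_zero] at h
  refine h.congr' ?_
  filter_upwards [eventually_gt_atTop 0] with t ht
  have := one_sub_ratio ht
  rw [one_div] at this
  linarith

lemma integrableOn_exp_neg_mul {u : ℝ} (hu : 0 < u) :
    IntegrableOn (fun t : ℝ => Real.exp (-(u * t))) (Ioi 0) := by
  simpa using integrableOn_exp_mul_Ioi (neg_lt_zero.mpr hu) 0

lemma laplace_one {u : ℝ} (hu : 0 < u) : laplace (fun _ => 1) u = 1 / u := by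
  unfold laplace
  have h := integral_exp_mul_Ioi (neg_lt_zero.mpr hu) 0
  simp only [mul_one, neg_mul, mul_zero, Real.exp_zero] at h ⊢
  rw [h]; simp

lemma integrableOn_laplace {g : ℝ → ℝ} {C u : ℝ} (hu : 0 < u) (hg : ContinuousOn g (Ioi 0))
    (hb : ∀ t, 0 < t → |g t| ≤ C) :
    IntegrableOn (fun t => Real.exp (-(u * t)) * g t) (Ioi 0) := by
  refine Integrable.mono' ((integrableOn_exp_neg_mul hu).mul_const C)
    (ContinuousOn.aestronglyMeasurable (by fun_prop) measurableSet_Ioi) ?_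
  filter_upwards [ae_restrict_mem measurableSet_Ioi] with t ht
  rw [norm_mul, Real.norm_eq_abs, Real.abs_exp, Real.norm_eq_abs]
  exact mul_le_mul_of_nonneg_left (hb t ht) (Real.exp_pos _).le

lemma hasDerivAt_laplace {g : ℝ → ℝ} {C C' u : ℝ} (hu : 0 < u) (hg : ContinuousOn g (Ioi 0))
    (hb : ∀ t, 0 < t → |g t| ≤ C) (hb' : ∀ t, 0 < t → |t * g t| ≤ C') :
    HasDerivAt (laplace g) (-laplace (fun t => t * g t) u) u := by
  have key := hasDerivAt_integral_of_dominated_loc_of_deriv_le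
    (μ := volume.restrict (Ioi (0 : ℝ))) (F := fun u t => Real.exp (-(u * t)) * g t)
    (F' := fun u t => -(Real.exp (-(u * t)) * (t * g t)))
    -- Uniform domination for parameters above `u/2`, a neighbourhood of `u`.
    (bound := fun t => Real.exp (-(u / 2 * t)) * C') (x₀ := u) (s := Ioi (u / 2))
    (Ioi_mem_nhds (by linarith)) ?_ (integrableOn_laplace hu hg hb) ?_ ?_ ?_ ?_
  · convert! key.2 using 1
    simp only [laplace, integral_neg]
  · exact Eventually.of_forall fun x =>
      ContinuousOn.aestronglyMeasurable (by fun_prop) measurableSet_Ioi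
  · exact ContinuousOn.aestronglyMeasurable (by fun_prop) measurableSet_Ioi
  · filter_upwards [ae_restrict_mem measurableSet_Ioi] with t ht x hx
    rw [norm_neg, norm_mul, Real.norm_eq_abs, Real.abs_exp, Real.norm_eq_abs]
    refine mul_le_mul (Real.exp_le_exp.mpr ?_) (hb' t ht) (abs_nonneg _) (Real.exp_pos _).le
    have : u / 2 * t ≤ x * t := mul_le_mul_of_nonneg_right (le_of_lt hx) (le_of_lt ht)
    linarith
  · exact (integrableOn_exp_neg_mul (half_pos hu)).mul_const C'
  · refine Eventually.of_forall fun t x _ => ?_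
    have h := ((((hasDerivAt_id x).mul_const t).neg).exp).mul_const (g t)
    convert! h using 1
    simp; ring

lemma laplace_congr {g h : ℝ → ℝ} (hgh : ∀ t, 0 < t → g t = h t) (u : ℝ) :
    laplace g u = laplace h u :=
  setIntegral_congr_fun measurableSet_Ioi fun t ht => by simp only [hgh t ht]

lemma laplace_mono {g h : ℝ → ℝ} {C C' u : ℝ} (hu : 0 < u) (hg : ContinuousOn g (Ioi 0))
    (hbg : ∀ t, 0 < t → |g t| ≤ C) (hh : ContinuousOn h (Ioi 0))
    (hbh : ∀ t, 0 < t → |h t| ≤ C') (hgh : ∀ t, 0 < t → g t ≤ h t) :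
    laplace g u ≤ laplace h u :=
  setIntegral_mono_on (integrableOn_laplace hu hg hbg) (integrableOn_laplace hu hh hbh)
    measurableSet_Ioi fun t ht => mul_le_mul_of_nonneg_left (hgh t ht) (Real.exp_pos _).le

lemma laplace_pos {g : ℝ → ℝ} {C u : ℝ} (hu : 0 < u) (hg : ContinuousOn g (Ioi 0))
    (hb : ∀ t, 0 < t → |g t| ≤ C) (hpos : ∀ t, 0 < t → 0 < g t) : 0 < laplace g u := by
  refine (setIntegral_pos_iff_support_of_nonneg_ae ?_ (integrableOn_laplace hu hg hb)).mpr ?_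
  · filter_upwards [ae_restrict_mem measurableSet_Ioi] with t ht
    exact (mul_pos (Real.exp_pos _) (hpos t ht)).le
  · have : Function.support (fun t => Real.exp (-(u * t)) * g t) ∩ Ioi 0 = Ioi 0 :=
      inter_eq_right.mpr fun t ht => (mul_pos (Real.exp_pos _) (hpos t ht)).ne'
    rw [this]; simp

lemma laplace_sub {g h : ℝ → ℝ} {C C' u : ℝ} (hu : 0 < u) (hg : ContinuousOn g (Ioi 0))
    (hbg : ∀ t, 0 < t → |g t| ≤ C) (hh : ContinuousOn h (Ioi 0))
    (hbh : ∀ t, 0 < t → |h t| ≤ C') :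
    laplace (fun t => g t - h t) u = laplace g u - laplace h u := by
  unfold laplace
  rw [← integral_sub (integrableOn_laplace hu hg hbg) (integrableOn_laplace hu hh hbh)]
  simp only [mul_sub]

lemma laplace_add {g h : ℝ → ℝ} {C C' u : ℝ} (hu : 0 < u) (hg : ContinuousOn g (Ioi 0))
    (hbg : ∀ t, 0 < t → |g t| ≤ C) (hh : ContinuousOn h (Ioi 0))
    (hbh : ∀ t, 0 < t → |h t| ≤ C') :
    laplace (fun t => g t + h t) u = laplace g u + laplace h u := by
  unfold laplace
  rw [← integral_add (integrableOn_laplace hu hg hbg) (integrableOn_laplace hu hh hbh)]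
  simp only [mul_add]

/-! ### The Kummer equation and its infrared regular solution. -/

/-- The density of the Laplace transform `kummerJ`. -/
def densJ (a t : ℝ) : ℝ := ratio t ^ a / (1 + t) ^ 2
/-- The density of the Laplace transform `kummerI`. -/
def densI (a t : ℝ) : ℝ := ratio t ^ (a + 1) / (1 + t)
/-- The density of the Laplace transform `kummerH`. -/
def densH (a t : ℝ) : ℝ := ratio t ^ (a + 2)
/-- The density of the Laplace transform `kummerK`. -/
def densK (t : ℝ) : ℝ := 1 / (1 + t)

/-- `Γ(a + 1) U(a + 1, 0, u)`, with `U` the Tricomi function. -/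
def kummerJ (a u : ℝ) : ℝ := laplace (densJ a) u
/-- Minus the derivative of `kummerJ`. -/
def kummerI (a u : ℝ) : ℝ := laplace (densI a) u
/-- Minus the derivative of `kummerI`. -/
def kummerH (a u : ℝ) : ℝ := laplace (densH a) u
/-- The reference transform `∫ e^{-ut} / (1 + t) dt`. -/
def kummerK (u : ℝ) : ℝ := laplace densK u

section densities
variable {a t : ℝ}

lemma densJ_pos (ht : 0 < t) : 0 < densJ a t :=
  div_pos (Real.rpow_pos_of_pos (ratio_pos ht) _) (by positivity)
lemma densI_pos (ht : 0 < t) : 0 < densI a t :=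
  div_pos (Real.rpow_pos_of_pos (ratio_pos ht) _) (by positivity)
lemma densH_pos (ht : 0 < t) : 0 < densH a t := Real.rpow_pos_of_pos (ratio_pos ht) _
lemma densK_pos (ht : 0 < t) : 0 < densK t := by unfold densK; positivity

/-- Differentiating a Laplace transform multiplies its density by `-t`, so this and `mul_densI` give
the chain `kummerJ → kummerI → kummerH` of derivatives up to sign. -/
lemma mul_densJ (ht : 0 < t) : t * densJ a t = densI a t := by
  unfold densJ densI
  rw [Real.rpow_add (ratio_pos ht), Real.rpow_one]
  nth_rw 3 [ratio]
  field_simp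

lemma mul_densI (ht : 0 < t) : t * densI a t = densH a t := by
  unfold densI densH
  rw [show a + 2 = a + 1 + 1 by ring, Real.rpow_add (ratio_pos ht) (a + 1), Real.rpow_one]
  nth_rw 3 [ratio]
  field_simp

lemma densK_le_one (ht : 0 < t) : densK t ≤ 1 := by
  unfold densK; rw [div_le_one (by linarith)]; linarith
lemma densI_le_densK (ha : 0 ≤ a) (ht : 0 < t) : densI a t ≤ densK t :=
  div_le_div_of_nonneg_right (ratio_rpow_le_one ht (by linarith)) (by linarith)
lemma densJ_le_one (ha : 0 ≤ a) (ht : 0 < t) : densJ a t ≤ 1 := by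
  unfold densJ
  rw [div_le_one (by positivity)]
  nlinarith [ratio_rpow_le_one ht ha]
lemma densH_le_one (ha : 0 ≤ a) (ht : 0 < t) : densH a t ≤ 1 :=
  ratio_rpow_le_one ht (by linarith)

lemma abs_densJ_le (ha : 0 ≤ a) (ht : 0 < t) : |densJ a t| ≤ 1 := by
  rw [abs_of_pos (densJ_pos ht)]; exact densJ_le_one ha ht
lemma abs_densK_le (ht : 0 < t) : |densK t| ≤ 1 := by
  rw [abs_of_pos (densK_pos ht)]; exact densK_le_one ht
lemma abs_densI_le (ha : 0 ≤ a) (ht : 0 < t) : |densI a t| ≤ 1 := by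
  rw [abs_of_pos (densI_pos ht)]; exact (densI_le_densK ha ht).trans (densK_le_one ht)
lemma abs_densH_le (ha : 0 ≤ a) (ht : 0 < t) : |densH a t| ≤ 1 := by
  rw [abs_of_pos (densH_pos ht)]; exact densH_le_one ha ht

lemma continuousOn_densJ : ContinuousOn (densJ a) (Ioi 0) :=
  (continuousOn_ratio_rpow a).div (by fun_prop) fun t (ht : 0 < t) => by positivity
lemma continuousOn_densI : ContinuousOn (densI a) (Ioi 0) :=
  (continuousOn_ratio_rpow _).div (by fun_prop) fun t (ht : 0 < t) => by positivity
lemma continuousOn_densH : ContinuousOn (densH a) (Ioi 0) := continuousOn_ratio_rpow _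
lemma continuousOn_densK : ContinuousOn densK (Ioi 0) :=
  continuousOn_const.div (by fun_prop) fun t (ht : 0 < t) => by positivity

end densities

section kummer
variable {a u : ℝ}

lemma kummerJ_pos (ha : 0 ≤ a) (hu : 0 < u) : 0 < kummerJ a u :=
  laplace_pos hu continuousOn_densJ (fun _ => abs_densJ_le ha) fun _ => densJ_pos
lemma kummerI_pos (ha : 0 ≤ a) (hu : 0 < u) : 0 < kummerI a u :=
  laplace_pos hu continuousOn_densI (fun _ => abs_densI_le ha) fun _ => densI_pos
lemma kummerK_pos (hu : 0 < u) : 0 < kummerK u :=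
  laplace_pos hu continuousOn_densK (fun _ => abs_densK_le) fun _ => densK_pos

lemma hasDerivAt_kummerJ (ha : 0 ≤ a) (hu : 0 < u) :
    HasDerivAt (kummerJ a) (-kummerI a u) u := by
  have h := hasDerivAt_laplace (g := densJ a) (C := 1) (C' := 1) hu continuousOn_densJ
    (fun _ => abs_densJ_le ha) fun t ht => by rw [mul_densJ ht]; exact abs_densI_le ha ht
  rwa [laplace_congr (fun t ht => mul_densJ ht)] at h

lemma hasDerivAt_kummerI (ha : 0 ≤ a) (hu : 0 < u) :
    HasDerivAt (kummerI a) (-kummerH a u) u := by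
  have h := hasDerivAt_laplace (g := densI a) (C := 1) (C' := 1) hu continuousOn_densI
    (fun _ => abs_densI_le ha) fun t ht => by rw [mul_densI ht]; exact abs_densH_le ha ht
  rwa [laplace_congr (fun t ht => mul_densI ht)] at h

/-- From `t/(1 + t) = 1 - 1/(1 + t)`. -/
lemma hasDerivAt_kummerK (hu : 0 < u) : HasDerivAt kummerK (kummerK u - 1 / u) u := by
  have e : ∀ t : ℝ, 0 < t → t * densK t = 1 - densK t := fun t ht => by
    unfold densK; field_simp; ring
  have h := hasDerivAt_laplace (g := densK) (C := 1) (C' := 1) hu continuousOn_densK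
    (fun _ => abs_densK_le) fun t ht => by
      rw [e t ht, abs_of_nonneg (by linarith [densK_le_one ht])]; linarith [densK_pos ht]
  rw [laplace_congr e, laplace_sub (C := 1) (C' := 1) hu continuousOn_const (by simp)
    continuousOn_densK (fun _ => abs_densK_le), laplace_one hu] at h
  rwa [neg_sub] at h

lemma kummerJ_le (ha : 0 ≤ a) (hu : 0 < u) : kummerJ a u ≤ 1 / u := by
  rw [← laplace_one hu]
  exact laplace_mono hu continuousOn_densJ (fun _ => abs_densJ_le ha) continuousOn_const
    (C' := 1) (by simp) fun _ => densJ_le_one ha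

lemma densH_add_densI {t : ℝ} (ht : 0 < t) : densH a t + densI a t = ratio t ^ (a + 1) := by
  have h := mul_densI (a := a) ht
  rw [← h]
  unfold densI
  field_simp
  ring

/-- Integration by parts. -/
lemma kummerJ_eq (ha : 0 ≤ a) (hu : 0 < u) :
    (a + 1) * kummerJ a u = u * laplace (fun t => ratio t ^ (a + 1)) u := by
  have hi1 := integrableOn_laplace hu (continuousOn_densJ (a := a)) (fun _ => abs_densJ_le ha)
  have hi2 := integrableOn_laplace (C := 1) hu (continuousOn_ratio_rpow (a + 1)) fun t ht => by
    rw [abs_of_nonneg (ratio_rpow_nonneg ht)]; exact ratio_rpow_le_one ht (by linarith)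
  have h := integral_Ioi_of_hasDerivAt_of_tendsto (a := 0) (m := 0)
    (f := fun t => Real.exp (-(u * t)) * ratio t ^ (a + 1))
    (f' := fun t => (a + 1) * (Real.exp (-(u * t)) * densJ a t) -
      u * (Real.exp (-(u * t)) * ratio t ^ (a + 1))) ?_ ?_ ?_ ?_
  · rw [integral_sub (hi1.const_mul _) (hi2.const_mul _), integral_const_mul,
      integral_const_mul] at h
    have h0 : ratio 0 ^ (a + 1) = 0 := by
      simp only [ratio, zero_div]; exact Real.zero_rpow (by linarith)
    rw [h0, mul_zero, sub_zero, sub_eq_zero] at h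
    exact h
  · have : ContinuousAt ratio 0 := by
      unfold ratio; exact continuousAt_id.div (by fun_prop) (by norm_num)
    refine ContinuousAt.continuousWithinAt (ContinuousAt.mul (by fun_prop) ?_)
    exact this.rpow_const (Or.inr (by linarith))
  · intro t ht
    have h1 := ((hasDerivAt_id t).const_mul u).neg.exp
    have h2 := (hasDerivAt_ratio ht).rpow_const (p := a + 1) (Or.inl (ratio_pos ht).ne')
    convert! h1.mul h2 using 1
    simp only [densJ, id, add_sub_cancel_right, mul_one, Pi.neg_apply]
    ring
  · exact (hi1.const_mul _).sub (hi2.const_mul _)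
  · have h1 : Tendsto (fun t : ℝ => Real.exp (-(u * t))) atTop (𝓝 0) :=
      Real.tendsto_exp_neg_atTop_nhds_zero.comp (tendsto_id.const_mul_atTop hu)
    have h2 : Tendsto (fun t : ℝ => ratio t ^ (a + 1)) atTop (𝓝 (1 ^ (a + 1))) :=
      tendsto_ratio_atTop.rpow_const (Or.inl one_ne_zero)
    simpa using h1.mul h2

lemma kummerJ_eq' (ha : 0 ≤ a) (hu : 0 < u) :
    (a + 1) * kummerJ a u = u * (kummerH a u + kummerI a u) := by
  rw [kummerJ_eq ha hu, kummerH, kummerI, ← laplace_add hu continuousOn_densH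
    (fun _ => abs_densH_le ha) continuousOn_densI (fun _ => abs_densI_le ha)]
  congr 1
  exact laplace_congr (fun t ht => (densH_add_densI ht).symm) u

/-- The solution of `u y'' - (1 + u) y' - a y = 0` that is regular at infinity, normalised
to `1 / (a + 1)` at `u = 0`. -/
def kummerN (a u : ℝ) : ℝ := u * kummerI a u + (1 + u) * kummerJ a u

lemma kummerN_pos (ha : 0 ≤ a) (hu : 0 < u) : 0 < kummerN a u := by
  have := kummerI_pos ha hu
  have := kummerJ_pos ha hu
  unfold kummerN; positivity

/-- The product rule gives `J - u(H + I)`, and integration by parts identifies `u(H + I)` with `(a +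
1)J`. Differentiating once more, with `J' = -I`, recovers the Kummer equation. Working with `J`
instead of `-N'/a` keeps `a = 0` regular. -/
lemma hasDerivAt_kummerN (ha : 0 ≤ a) (hu : 0 < u) :
    HasDerivAt (kummerN a) (-(a * kummerJ a u)) u := by
  have h := ((hasDerivAt_id u).mul (hasDerivAt_kummerI ha hu)).add
    (((hasDerivAt_id u).const_add 1).mul (hasDerivAt_kummerJ ha hu))
  convert! h using 1
  have := kummerJ_eq' ha hu
  simp only [id]
  linarith

/-- Minus the logarithmic derivative of the infrared regular solution, divided by `a`. -/
def kummerR (a u : ℝ) : ℝ := kummerJ a u / kummerN a u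

/-- The quotient rule, with `I` eliminated through the definition of `N`, closes into a Riccati
equation. -/
lemma hasDerivAt_kummerR (ha : 0 ≤ a) (hu : 0 < u) :
    HasDerivAt (kummerR a)
      ((-1 + (1 + u) * kummerR a u + a * u * kummerR a u ^ 2) / u) u := by
  have hN := (kummerN_pos ha hu).ne'
  have h := (hasDerivAt_kummerJ ha hu).div (hasDerivAt_kummerN ha hu) hN
  convert! h using 1
  have e : kummerI a u = (kummerN a u - (1 + u) * kummerJ a u) / u := by
    unfold kummerN; field_simp; ring
  rw [e]
  unfold kummerR
  field_simp
  ring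

end kummer

/-! ### Expansion at the boundary `u → 0` and harmonic numbers. -/

/-- The analytic continuation of the harmonic numbers, `H_{a+1}`, as an integral. -/
def harmonicShift (a : ℝ) : ℝ := ∫ t in Ioi (0 : ℝ), (1 - ratio t ^ (a + 1)) / (1 + t)

/-- The constant term of `kummerK u + log u` as `u → 0⁺`. -/
def kummerConst : ℝ := sInf ((fun u => kummerK u + Real.log u) '' Ioi 0)

/-- Truncating the integral at `t = 1/u`, where `e^{-ut} ≥ 1 - ut ≥ 0`, leaves the elementary
integral `(1 + u) log(1 + 1/u) - 1`. -/
lemma neg_one_le_kummerK_add_log {u : ℝ} (hu : 0 < u) : -1 ≤ kummerK u + Real.log u := by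
  have hi := integrableOn_laplace hu continuousOn_densK (fun _ => abs_densK_le)
  have h1 : ∫ t in Ioc 0 (1 / u), Real.exp (-(u * t)) * densK t ≤ kummerK u :=
    setIntegral_mono_set hi
      ((ae_restrict_mem measurableSet_Ioi).mono fun t ht =>
        (mul_pos (Real.exp_pos _) (densK_pos ht)).le)
      (Ioc_subset_Ioi_self.eventuallyLE)
  have hpos : (0 : ℝ) ≤ 1 / u := by positivity
  have hcont : ContinuousOn (fun t : ℝ => (1 + u) / (1 + t) - u) (Icc 0 (1 / u)) :=
    (continuousOn_const.div (by fun_prop) fun t ht => by linarith [ht.1]).sub continuousOn_const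
  have h2 : ∫ t in Ioc 0 (1 / u), ((1 + u) / (1 + t) - u) ≤
      ∫ t in Ioc 0 (1 / u), Real.exp (-(u * t)) * densK t := by
    refine setIntegral_mono_on ?_ (hi.mono_set Ioc_subset_Ioi_self) measurableSet_Ioc ?_
    · exact (hcont.integrableOn_Icc).mono_set Ioc_subset_Icc_self
    · intro t ht
      have ht' : 0 < 1 + t := by linarith [ht.1]
      have : (1 + u) / (1 + t) - u = (1 - u * t) * densK t := by unfold densK; field_simp; ring
      rw [this]
      refine mul_le_mul_of_nonneg_right ?_ (densK_pos ht.1).le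
      linarith [Real.add_one_le_exp (-(u * t))]
  have h3 : ∫ t in Ioc 0 (1 / u), ((1 + u) / (1 + t) - u) =
      (1 + u) * Real.log (1 + 1 / u) - 1 := by
    rw [← intervalIntegral.integral_of_le hpos,
      intervalIntegral.integral_eq_sub_of_hasDerivAt
        (f := fun t => (1 + u) * Real.log (1 + t) - u * t)]
    · simp [hu.ne']
    · intro t ht
      rw [uIcc_of_le hpos] at ht
      have h1t : 1 + t ≠ 0 := by linarith [ht.1]
      have := ((((hasDerivAt_id t).const_add 1).log h1t).const_mul (1 + u)).sub
        ((hasDerivAt_id t).const_mul u)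
      convert! this using 1
      simp only [id]; ring
    · rw [← uIcc_of_le hpos] at hcont
      exact hcont.intervalIntegrable
  have h4 : -Real.log u ≤ Real.log (1 + 1 / u) := by
    rw [← Real.log_inv]
    exact Real.log_le_log (by positivity) (by rw [one_div]; linarith)
  have h5 : 0 ≤ Real.log (1 + 1 / u) := Real.log_nonneg (by linarith)
  nlinarith

/-- The derivative of `kummerK u + log u` is `kummerK u > 0`, so the function is monotone; being
bounded below, it converges at `0⁺` to its infimum. The value of the limit is irrelevant: it ends up
in the contact terms. -/
lemma tendsto_kummerK_add_log :
    Tendsto (fun u => kummerK u + Real.log u) (𝓝[>] 0) (𝓝 kummerConst) := by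
  have hd : ∀ u : ℝ, 0 < u → HasDerivAt (fun u => kummerK u + Real.log u) (kummerK u) u := by
    intro u hu
    convert! (hasDerivAt_kummerK hu).add (Real.hasDerivAt_log hu.ne') using 1
    rw [one_div]; ring
  refine MonotoneOn.tendsto_nhdsGT ?_ ⟨-1, ?_⟩
  · refine monotoneOn_of_deriv_nonneg (convex_Ioi 0)
      (fun u hu => (hd u hu).continuousAt.continuousWithinAt) ?_ ?_ <;> rw [interior_Ioi]
    · exact fun u hu => (hd u hu).differentiableAt.differentiableWithinAt
    · intro u hu
      rw [(hd u hu).deriv]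
      exact (kummerK_pos hu).le
  · rintro _ ⟨u, hu, rfl⟩
    exact neg_one_le_kummerK_add_log hu

/-- Since `ratio' = 1/(1 + t)²`, the integrand has primitive `ratio^(b+1)/(b+1)`. -/
lemma integral_ratio_rpow {b : ℝ} (hb : 0 ≤ b) :
    IntegrableOn (fun t => ratio t ^ b / (1 + t) ^ 2) (Ioi 0) ∧
      ∫ t in Ioi (0 : ℝ), ratio t ^ b / (1 + t) ^ 2 = 1 / (b + 1) := by
  have hc : ContinuousWithinAt (fun t => ratio t ^ (b + 1) / (b + 1)) (Ici 0) 0 := by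
    have : ContinuousAt ratio 0 := by
      unfold ratio; exact continuousAt_id.div (by fun_prop) (by norm_num)
    exact ((this.rpow_const (Or.inr (by linarith))).div_const _).continuousWithinAt
  have hd : ∀ t ∈ Ioi (0 : ℝ), HasDerivAt (fun t => ratio t ^ (b + 1) / (b + 1))
      (ratio t ^ b / (1 + t) ^ 2) t := by
    intro t ht
    have hb1 : b + 1 ≠ 0 := by linarith
    convert! ((hasDerivAt_ratio ht).rpow_const (p := b + 1)
      (Or.inl (ratio_pos ht).ne')).div_const (b + 1) using 1
    rw [add_sub_cancel_right]
    field_simp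
  have hp : ∀ t ∈ Ioi (0 : ℝ), 0 ≤ ratio t ^ b / (1 + t) ^ 2 := fun t ht =>
    div_nonneg (ratio_rpow_nonneg ht) (by positivity)
  have ht : Tendsto (fun t => ratio t ^ (b + 1) / (b + 1)) atTop (𝓝 (1 ^ (b + 1) / (b + 1))) :=
    (tendsto_ratio_atTop.rpow_const (Or.inl one_ne_zero)).div_const _
  refine ⟨integrableOn_Ioi_deriv_of_nonneg hc hd hp ht, ?_⟩
  rw [integral_Ioi_of_hasDerivAt_of_nonneg hc hd hp ht]
  have h0 : ratio 0 ^ (b + 1) = 0 := by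
    simp only [ratio, zero_div]; exact Real.zero_rpow (by linarith)
  rw [h0, Real.one_rpow, zero_div, sub_zero]

lemma harmonic_term_nonneg {a : ℝ} (ha : 0 ≤ a) (n : ℕ) :
    0 ≤ 1 / ((n : ℝ) + 1) - 1 / ((n : ℝ) + a + 2) :=
  sub_nonneg.mpr (one_div_le_one_div_of_le (by positivity) (by linarith))

lemma harmonic_term_le {a : ℝ} (ha : 0 ≤ a) (n : ℕ) :
    1 / ((n : ℝ) + 1) - 1 / ((n : ℝ) + a + 2) ≤ (a + 1) * (1 / ((n : ℝ) + 1) ^ 2) := by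
  have : 1 / ((n : ℝ) + 1) - 1 / ((n : ℝ) + a + 2) =
      (a + 1) * (1 / (((n : ℝ) + 1) * ((n : ℝ) + a + 2))) := by
    field_simp
    ring
  rw [this]
  refine mul_le_mul_of_nonneg_left (one_div_le_one_div_of_le (by positivity) ?_) (by linarith)
  have : (0 : ℝ) ≤ n := n.cast_nonneg
  nlinarith

lemma summable_one_div_succ_sq : Summable fun n : ℕ => 1 / ((n : ℝ) + 1) ^ 2 := by
  have h := (summable_nat_add_iff 1).mpr (Real.summable_one_div_nat_pow.mpr one_lt_two)
  simpa using h

/-- Because `1 - ratio t = 1/(1 + t)`, the geometric series in `ratio t` turns `1/(1 + t)²` into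
`1/(1 + t)`; the integrals of its terms are differences of `integral_ratio_rpow`, and the terms are
nonnegative. -/
lemma hasSum_harmonicShift {a : ℝ} (ha : 0 ≤ a) :
    HasSum (fun n : ℕ => 1 / ((n : ℝ) + 1) - 1 / ((n : ℝ) + a + 2)) (harmonicShift a) := by
  let F : ℕ → ℝ → ℝ := fun n t =>
    ratio t ^ (n : ℝ) / (1 + t) ^ 2 - ratio t ^ ((n : ℝ) + (a + 1)) / (1 + t) ^ 2
  have h1 : ∀ n : ℕ, _ := fun n => integral_ratio_rpow (b := (n : ℝ)) n.cast_nonneg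
  have h2 : ∀ n : ℕ, _ := fun n =>
    integral_ratio_rpow (b := (n : ℝ) + (a + 1)) (by have := n.cast_nonneg (α := ℝ); linarith)
  have hF : ∀ n, IntegrableOn (F n) (Ioi 0) := fun n => (h1 n).1.sub (h2 n).1
  have hFint : ∀ n, ∫ t in Ioi (0 : ℝ), F n t = 1 / ((n : ℝ) + 1) - 1 / ((n : ℝ) + a + 2) := by
    intro n
    rw [integral_sub (h1 n).1 (h2 n).1, (h1 n).2, (h2 n).2]
    ring_nf
  have hF0 : ∀ n, ∀ t ∈ Ioi (0 : ℝ), F n t =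
      ratio t ^ n * ((1 - ratio t ^ (a + 1)) / (1 + t) ^ 2) := by
    intro n t ht
    simp only [F]
    rw [Real.rpow_add (ratio_pos ht), Real.rpow_natCast]
    ring
  have hnorm : ∀ n, ∫ t in Ioi (0 : ℝ), ‖F n t‖ = 1 / ((n : ℝ) + 1) - 1 / ((n : ℝ) + a + 2) := by
    intro n
    rw [← hFint n]
    refine setIntegral_congr_fun measurableSet_Ioi fun t ht => ?_
    rw [Real.norm_eq_abs, abs_of_nonneg]
    rw [hF0 n t ht]
    exact mul_nonneg (pow_nonneg (ratio_pos ht).le _)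
      (div_nonneg (by linarith [ratio_rpow_le_one ht (show 0 ≤ a + 1 by linarith)])
        (by positivity))
  have hs : Summable fun n : ℕ => 1 / ((n : ℝ) + 1) - 1 / ((n : ℝ) + a + 2) :=
    Summable.of_nonneg_of_le (harmonic_term_nonneg ha) (harmonic_term_le ha)
      (summable_one_div_succ_sq.mul_left _)
  have key := hasSum_integral_of_summable_integral_norm (μ := volume.restrict (Ioi (0 : ℝ))) hF
    (by simpa only [hnorm] using hs)
  simp only [hFint] at key
  convert! key using 1
  refine setIntegral_congr_fun measurableSet_Ioi fun t (ht : 0 < t) => ?_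
  have : ∑' n, F n t = ∑' n, ratio t ^ n * ((1 - ratio t ^ (a + 1)) / (1 + t) ^ 2) :=
    tsum_congr fun n => hF0 n t ht
  rw [this, tsum_mul_right, tsum_geometric_of_lt_one (ratio_pos ht).le (ratio_lt_one ht),
    one_sub_ratio ht]
  field_simp

/-- Both transforms diverge logarithmically, but the difference of densities is at most `(a + 1)/(1
+ t)²`, so dominated convergence applies at `u = 0`. -/
lemma tendsto_kummerK_sub_kummerI {a : ℝ} (ha : 0 ≤ a) :
    Tendsto (fun u => kummerK u - kummerI a u) (𝓝[>] 0) (𝓝 (harmonicShift a)) := by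
  have hcont : ContinuousOn (fun t => (1 - ratio t ^ (a + 1)) / (1 + t)) (Ioi 0) :=
    (continuousOn_const.sub (continuousOn_ratio_rpow _)).div (by fun_prop)
      fun t (ht : 0 < t) => by positivity
  have h : Tendsto (fun u => laplace (fun t => (1 - ratio t ^ (a + 1)) / (1 + t)) u) (𝓝[>] 0)
      (𝓝 (harmonicShift a)) := by
    refine tendsto_integral_filter_of_dominated_convergence
      (fun t => (a + 1) * (1 / (1 + t) ^ 2)) ?_ ?_ ?_ ?_
    · exact Eventually.of_forall fun u =>
        ContinuousOn.aestronglyMeasurable (by fun_prop) measurableSet_Ioi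
    · filter_upwards [self_mem_nhdsWithin] with u (hu : 0 < u)
      filter_upwards [ae_restrict_mem measurableSet_Ioi] with t (ht : 0 < t)
      have h1 := one_sub_ratio_rpow_le ht ha
      have h2 := ratio_rpow_le_one ht (show 0 ≤ a + 1 by linarith)
      rw [norm_mul, Real.norm_eq_abs, Real.abs_exp, Real.norm_eq_abs,
        abs_of_nonneg (div_nonneg (by linarith) (by linarith))]
      have h3 : Real.exp (-(u * t)) ≤ 1 := Real.exp_le_one_iff.mpr (by nlinarith)
      have h4 : (1 - ratio t ^ (a + 1)) / (1 + t) ≤ (a + 1) * (1 / (1 + t) ^ 2) := by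
        calc (1 - ratio t ^ (a + 1)) / (1 + t) ≤ ((a + 1) / (1 + t)) / (1 + t) :=
              div_le_div_of_nonneg_right h1 (by linarith)
          _ = _ := by field_simp
      calc _ ≤ 1 * ((1 - ratio t ^ (a + 1)) / (1 + t)) :=
            mul_le_mul_of_nonneg_right h3 (div_nonneg (by linarith) (by linarith))
        _ ≤ _ := by rw [one_mul]; exact h4
    · have := (integral_ratio_rpow le_rfl).1
      simp only [Real.rpow_zero] at this
      exact this.const_mul _
    · refine Eventually.of_forall fun t => ?_
      have : Tendsto (fun u : ℝ => Real.exp (-(u * t)) * ((1 - ratio t ^ (a + 1)) / (1 + t)))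
          (𝓝 0) (𝓝 (Real.exp (-(0 * t)) * ((1 - ratio t ^ (a + 1)) / (1 + t)))) :=
        Continuous.tendsto (by fun_prop) 0
      simpa using this.mono_left nhdsWithin_le_nhds
  refine h.congr' ?_
  filter_upwards [self_mem_nhdsWithin] with u (hu : 0 < u)
  rw [kummerK, kummerI, ← laplace_sub hu continuousOn_densK (fun _ => abs_densK_le)
    continuousOn_densI (fun _ => abs_densI_le ha)]
  refine laplace_congr (fun t _ => ?_) u
  unfold densK densI
  ring

/-- After integration by parts and `1 = u ∫ e^{-ut} dt`, the difference is `u` times the transform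
of `1 - ratio^(a+1)`, which Bernoulli bounds by `(a + 1) kummerK`. -/
lemma abs_one_sub_kummerJ_le {a u : ℝ} (ha : 0 ≤ a) (hu : 0 < u) :
    |1 - (a + 1) * kummerJ a u| ≤ u * ((a + 1) * kummerK u) := by
  have hb : ∀ t, 0 < t → |ratio t ^ (a + 1)| ≤ 1 := fun t ht => by
    rw [abs_of_nonneg (ratio_rpow_nonneg ht)]; exact ratio_rpow_le_one ht (by linarith)
  have hd : ∀ t, 0 < t → |1 - ratio t ^ (a + 1)| ≤ 1 := fun t ht => by
    rw [abs_of_nonneg (by linarith [ratio_rpow_le_one ht (show 0 ≤ a + 1 by linarith)])]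
    linarith [ratio_rpow_nonneg (a := a + 1) ht]
  have hcd : ContinuousOn (fun t => 1 - ratio t ^ (a + 1)) (Ioi 0) :=
    continuousOn_const.sub (continuousOn_ratio_rpow _)
  have e : 1 - (a + 1) * kummerJ a u = u * laplace (fun t => 1 - ratio t ^ (a + 1)) u := by
    rw [kummerJ_eq ha hu, laplace_sub (C := 1) hu continuousOn_const (by simp)
      (continuousOn_ratio_rpow _) hb, laplace_one hu]
    field_simp
  rw [e, abs_mul, abs_of_pos hu]
  refine mul_le_mul_of_nonneg_left ?_ hu.le
  have h1 : laplace (fun t => 1 - ratio t ^ (a + 1)) u ≤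
      laplace (fun t => (a + 1) * densK t) u := by
    refine laplace_mono hu hcd hd (continuousOn_densK.const_mul _) (C' := a + 1) ?_ ?_
    · intro t ht
      rw [abs_mul, abs_of_nonneg (show 0 ≤ a + 1 by linarith)]
      exact mul_le_of_le_one_right (by linarith) (abs_densK_le ht)
    · intro t ht
      have := one_sub_ratio_rpow_le ht ha
      unfold densK
      rwa [mul_one_div]
  have h2 : laplace (fun t => (a + 1) * densK t) u = (a + 1) * kummerK u := by
    simp only [laplace, kummerK, mul_left_comm _ (a + 1), integral_const_mul]
  have h0 : 0 ≤ laplace (fun t => 1 - ratio t ^ (a + 1)) u :=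
    setIntegral_nonneg measurableSet_Ioi fun t ht => mul_nonneg (Real.exp_pos _).le
      (by linarith [ratio_rpow_le_one ht (show 0 ≤ a + 1 by linarith)])
  rw [abs_of_nonneg h0, ← h2]
  exact h1

/-- The expansion of `kummerR` at `0`, to the order `o(u)`. -/
lemma tendsto_kummerR {a : ℝ} (ha : 0 ≤ a) :
    Tendsto (fun u => (kummerR a u - 1 + u - (a + 1) * (u * Real.log u)) / u) (𝓝[>] 0)
      (𝓝 (-((a + 1) * (kummerConst - harmonicShift a)))) := by
  -- Every error below is a product of factors growing at most like `log u`; half powers of `u`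
  -- absorb them one at a time.
  have hsq : Tendsto (fun u : ℝ => √u) (𝓝[>] 0) (𝓝 0) := by
    simpa using (Real.continuous_sqrt.tendsto 0).mono_left nhdsWithin_le_nhds
  have hlog : Tendsto (fun u : ℝ => √u * Real.log u) (𝓝[>] 0) (𝓝 0) := by
    simpa [Real.sqrt_eq_rpow, mul_comm] using
      tendsto_log_mul_rpow_nhdsGT_zero (show (0 : ℝ) < 1 / 2 by norm_num)
  have hK := tendsto_kummerK_add_log
  have hKs : Tendsto (fun u => √u * kummerK u) (𝓝[>] 0) (𝓝 0) := by
    have := (hsq.mul hK).sub hlog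
    simp only [zero_mul, sub_zero] at this
    exact this.congr fun u => by ring
  have hI : Tendsto (fun u => kummerI a u + Real.log u) (𝓝[>] 0)
      (𝓝 (kummerConst - harmonicShift a)) :=
    (hK.sub (tendsto_kummerK_sub_kummerI ha)).congr fun u => by ring
  have hIs : Tendsto (fun u => √u * kummerI a u) (𝓝[>] 0) (𝓝 0) := by
    have := (hsq.mul hI).sub hlog
    simp only [zero_mul, sub_zero] at this
    exact this.congr fun u => by ring
  have hJs : Tendsto (fun u => (1 - (a + 1) * kummerJ a u) / √u) (𝓝[>] 0) (𝓝 0) := by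
    refine squeeze_zero_norm' (a := fun u => (a + 1) * (√u * kummerK u)) ?_
      (by simpa using hKs.const_mul (a + 1))
    filter_upwards [self_mem_nhdsWithin] with u (hu : 0 < u)
    have hs := Real.sqrt_pos.mpr hu
    rw [Real.norm_eq_abs, abs_div, abs_of_pos hs, div_le_iff₀ hs]
    calc _ ≤ _ := abs_one_sub_kummerJ_le ha hu
      _ = (√u * √u) * ((a + 1) * kummerK u) := by rw [Real.mul_self_sqrt hu.le]
      _ = _ := by ring
  have hJ : Tendsto (fun u => kummerJ a u) (𝓝[>] 0) (𝓝 (1 / (a + 1))) := by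
    have := (tendsto_const_nhds (x := (1 : ℝ))).sub (hJs.mul hsq)
    simp only [zero_mul, sub_zero] at this
    refine (this.div_const (a + 1)).congr' ?_
    filter_upwards [self_mem_nhdsWithin] with u (hu : 0 < u)
    have hs := Real.sqrt_pos.mpr hu
    field_simp
    ring
  have ha1 : 1 / (a + 1) ≠ 0 := by positivity
  have hq : Tendsto (fun u => kummerI a u / kummerJ a u + (a + 1) * Real.log u) (𝓝[>] 0)
      (𝓝 ((a + 1) * (kummerConst - harmonicShift a))) := by
    have := ((hIs.mul hJs).div hJ ha1).add (hI.const_mul (a + 1))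
    simp only [zero_mul, zero_div, zero_add] at this
    refine this.congr' ?_
    filter_upwards [self_mem_nhdsWithin] with u (hu : 0 < u)
    have hs := Real.sqrt_pos.mpr hu
    have := kummerJ_pos ha hu
    simp only [Pi.div_apply]
    field_simp
    ring
  have hqs : Tendsto (fun u => √u * (1 + kummerI a u / kummerJ a u)) (𝓝[>] 0) (𝓝 0) := by
    have := (hsq.mul (hq.const_add 1)).sub (hlog.const_mul (a + 1))
    simp only [zero_mul, mul_zero, sub_zero] at this
    exact this.congr fun u => by ring
  have hw : Tendsto (fun u => u * (1 + kummerI a u / kummerJ a u)) (𝓝[>] 0) (𝓝 0) := by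
    have := hsq.mul hqs
    simp only [zero_mul] at this
    refine this.congr' ?_
    filter_upwards [self_mem_nhdsWithin] with u (hu : 0 < u)
    rw [← mul_assoc, Real.mul_self_sqrt hu.le]
  -- With `q = I/J` and `w = u(1 + q)`, `R = 1/(1 + w) = 1 - w + w²/(1 + w)`. The linear part gives
  -- the limit in `hq`, and the remainder divided by `u` is `(√u (1 + q))²/(1 + w)`.
  have key := hq.neg.add ((hqs.mul hqs).div (hw.const_add 1) (by norm_num))
  simp only [mul_zero, zero_div, add_zero] at key
  refine key.congr' ?_
  filter_upwards [self_mem_nhdsWithin] with u (hu : 0 < u)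
  have hJp := kummerJ_pos ha hu
  have hIp := kummerI_pos ha hu
  simp only [Pi.div_apply]
  set q := kummerI a u / kummerJ a u with hqdef
  have hqp : 0 < q := div_pos hIp hJp
  have hR : kummerR a u = 1 / (1 + u * (1 + q)) := by
    unfold kummerR kummerN
    rw [hqdef]
    field_simp
    ring
  rw [hR, show √u * (1 + q) * (√u * (1 + q)) = (√u * √u) * (1 + q) ^ 2 by ring,
    Real.mul_self_sqrt hu.le]
  have : 0 < 1 + u * (1 + q) := by positivity
  field_simp
  ring

/-! ### The response function: infrared regularity and uniqueness. -/

section warp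
variable {L Λ z : ℝ}

lemma exp_warp (hL : 0 < L) (hz : 0 < z) :
    Real.exp (warp L Λ z) = L / z * Real.exp (-(Λ ^ 2 * z ^ 2) / 2) := by
  rw [warp, Real.exp_add, Real.exp_log (div_pos hL hz), mul_comm]

lemma exp_neg_warp (hL : 0 < L) (hz : 0 < z) :
    Real.exp (-warp L Λ z) = z / L * Real.exp (Λ ^ 2 * z ^ 2 / 2) := by
  rw [Real.exp_neg, exp_warp hL hz, mul_inv, inv_div, ← Real.exp_neg]
  ring_nf

lemma hasDerivAt_warp (hL : 0 < L) (hz : 0 < z) :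
    HasDerivAt (warp L Λ) (-(Λ ^ 2 * z) - 1 / z) z := by
  have h1 : HasDerivAt (fun z : ℝ => -(Λ ^ 2 * z ^ 2) / 2) (-(Λ ^ 2 * (2 * z)) / 2) z := by
    simpa using (((hasDerivAt_pow 2 z).const_mul (Λ ^ 2)).neg).div_const 2
  have h2 : HasDerivAt (fun z : ℝ => Real.log (L / z)) ((L * -(z ^ 2)⁻¹) / (L / z)) z := by
    have := ((hasDerivAt_inv hz.ne').const_mul L).log (mul_pos hL (inv_pos.mpr hz)).ne'
    simpa [div_eq_mul_inv] using this
  convert! h1.add h2 using 1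
  field_simp
  ring

/-- `e^{-3A}` is the Wronskian of the linearised equation up to a constant; its growth excludes a
second regular solution. -/
lemma tendsto_exp_neg_three_warp (hL : 0 < L) :
    Tendsto (fun z => Real.exp (-(3 * warp L Λ z))) atTop atTop := by
  have h : Tendsto (fun z : ℝ => z ^ 3 / L ^ 3) atTop atTop :=
    (tendsto_pow_atTop (by norm_num)).atTop_div_const (by positivity)
  refine tendsto_atTop_mono' _ ?_ h
  filter_upwards [eventually_gt_atTop 0] with z hz
  have : Real.exp (-(3 * warp L Λ z)) = Real.exp (-warp L Λ z) ^ 3 := by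
    rw [← Real.exp_nat_mul]; push_cast; ring_nf
  rw [this, exp_neg_warp hL hz, mul_pow, div_pow]
  exact le_mul_of_one_le_right (by positivity)
    (one_le_pow₀ (Real.one_le_exp (by positivity)))

end warp

/-- The infrared regular solution of the Riccati equation. -/
def response (L Λ s z : ℝ) : ℝ :=
  s / (2 * L) * z ^ 2 * Real.exp (Λ ^ 2 * z ^ 2 / 2) *
    kummerR (s / (6 * Λ ^ 2)) (3 * Λ ^ 2 / 2 * z ^ 2)

/-- The tensor fluctuation whose response function is `response`. -/
def fluctuation (Λ s z : ℝ) : ℝ := kummerN (s / (6 * Λ ^ 2)) (3 * Λ ^ 2 / 2 * z ^ 2)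

section response
variable {L Λ s z : ℝ}

lemma isResponse_response (hL : 0 < L) (hΛ : 0 < Λ) (hs : 0 ≤ s) :
    IsResponse L Λ s (response L Λ s) := by
  intro z hz
  have ha : 0 ≤ s / (6 * Λ ^ 2) := by positivity
  have hu : 0 < 3 * Λ ^ 2 / 2 * z ^ 2 := by positivity
  have hR := (hasDerivAt_kummerR ha hu).comp z ((hasDerivAt_pow 2 z).const_mul (3 * Λ ^ 2 / 2))
  have h1 : HasDerivAt (fun z : ℝ => Real.exp (Λ ^ 2 * z ^ 2 / 2))
      (Real.exp (Λ ^ 2 * z ^ 2 / 2) * (Λ ^ 2 * z)) z := by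
    convert! (((hasDerivAt_pow 2 z).const_mul (Λ ^ 2)).div_const 2).exp using 1
    push_cast; ring
  have h := (((hasDerivAt_pow 2 z).const_mul (s / (2 * L))).mul h1).mul hR
  have hE : HasDerivAt (response L Λ s)
      ((s / (2 * L) * ((2 : ℕ) * z ^ (2 - 1)) * Real.exp (Λ ^ 2 * z ^ 2 / 2) + s / (2 * L) * z ^ 2 *
        (Real.exp (Λ ^ 2 * z ^ 2 / 2) * (Λ ^ 2 * z))) *
          kummerR (s / (6 * Λ ^ 2)) (3 * Λ ^ 2 / 2 * z ^ 2) +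
        (s / (2 * L) * z ^ 2 * Real.exp (Λ ^ 2 * z ^ 2 / 2)) * _) z := h
  refine ⟨hE.differentiableAt, ?_⟩
  rw [hE.deriv, (hasDerivAt_warp hL hz).deriv, exp_warp hL hz, exp_neg_warp hL hz, response]
  set R := kummerR (s / (6 * Λ ^ 2)) (3 * Λ ^ 2 / 2 * z ^ 2)
  have e : Real.exp (-(Λ ^ 2 * z ^ 2) / 2) = (Real.exp (Λ ^ 2 * z ^ 2 / 2))⁻¹ := by
    rw [← Real.exp_neg]; ring_nf
  rw [e]
  have hX := Real.exp_pos (Λ ^ 2 * z ^ 2 / 2)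
  set X := Real.exp (Λ ^ 2 * z ^ 2 / 2)
  push_cast
  field_simp
  ring

lemma response_nonneg (hL : 0 < L) (hΛ : 0 < Λ) (hs : 0 ≤ s) (hz : 0 < z) :
    0 ≤ response L Λ s z := by
  have ha : 0 ≤ s / (6 * Λ ^ 2) := by positivity
  have hu : 0 < 3 * Λ ^ 2 / 2 * z ^ 2 := by positivity
  have := (div_pos (kummerJ_pos ha hu) (kummerN_pos ha hu)).le
  unfold response kummerR
  positivity

/-- `E ≥ 0`, so the exponent is nonpositive and the fluctuation stays bounded. -/
lemma isIRRegular_response (hL : 0 < L) (hΛ : 0 < Λ) (hs : 0 ≤ s) :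
    IsIRRegular L Λ (response L Λ s) := by
  refine ⟨1, one_pos, 0, fun z hz => ?_⟩
  rw [neg_nonpos]
  refine intervalIntegral.integral_nonneg hz fun t ht => mul_nonneg (Real.exp_pos _).le ?_
  exact response_nonneg hL hΛ hs (by linarith [ht.1])

lemma fluctuation_pos (hΛ : 0 < Λ) (hs : 0 ≤ s) (hz : 0 < z) : 0 < fluctuation Λ s z :=
  kummerN_pos (by positivity) (by positivity)

lemma exp_warp_mul_response_mul_fluctuation (hL : 0 < L) (hΛ : 0 < Λ) (hs : 0 ≤ s) (hz : 0 < z) :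
    Real.exp (warp L Λ z) * response L Λ s z * fluctuation Λ s z =
      s / 2 * z * kummerJ (s / (6 * Λ ^ 2)) (3 * Λ ^ 2 / 2 * z ^ 2) := by
  have hN := kummerN_pos (a := s / (6 * Λ ^ 2)) (u := 3 * Λ ^ 2 / 2 * z ^ 2)
    (by positivity) (by positivity)
  rw [exp_warp hL hz, response, fluctuation, kummerR, neg_div, Real.exp_neg]
  generalize kummerN (s / (6 * Λ ^ 2)) (3 * Λ ^ 2 / 2 * z ^ 2) = N at *
  generalize kummerJ (s / (6 * Λ ^ 2)) (3 * Λ ^ 2 / 2 * z ^ 2) = J at *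
  have hX := Real.exp_pos (Λ ^ 2 * z ^ 2 / 2)
  field_simp

lemma hasDerivAt_fluctuation (hL : 0 < L) (hΛ : 0 < Λ) (hs : 0 ≤ s) (hz : 0 < z) :
    HasDerivAt (fluctuation Λ s)
      (-(Real.exp (warp L Λ z) * response L Λ s z) * fluctuation Λ s z) z := by
  have ha : 0 ≤ s / (6 * Λ ^ 2) := by positivity
  have hu : 0 < 3 * Λ ^ 2 / 2 * z ^ 2 := by positivity
  have h : HasDerivAt (fluctuation Λ s) _ z :=
    (hasDerivAt_kummerN ha hu).comp z ((hasDerivAt_pow 2 z).const_mul (3 * Λ ^ 2 / 2))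
  convert! h using 1
  rw [neg_mul, exp_warp_mul_response_mul_fluctuation hL hΛ hs hz]
  push_cast
  field_simp
  ring

/-- The product is `-U'` for the fluctuation `U`, and `J ≤ 1/u` makes it `O(1/z)`. This bound
controls the regular solution in the Wronskian identity. -/
lemma exp_warp_mul_response_mul_fluctuation_le (hL : 0 < L) (hΛ : 0 < Λ) (hs : 0 ≤ s)
    (hz : 1 ≤ z) :
    Real.exp (warp L Λ z) * response L Λ s z * fluctuation Λ s z ≤ s / (3 * Λ ^ 2) := by
  have hz0 : 0 < z := by linarith
  rw [exp_warp_mul_response_mul_fluctuation hL hΛ hs hz0]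
  have h := kummerJ_le (a := s / (6 * Λ ^ 2)) (u := 3 * Λ ^ 2 / 2 * z ^ 2)
    (by positivity) (by positivity)
  calc _ ≤ s / 2 * z * (1 / (3 * Λ ^ 2 / 2 * z ^ 2)) :=
        mul_le_mul_of_nonneg_left h (by positivity)
    _ = s / (3 * Λ ^ 2) * (1 / z) := by field_simp
    _ ≤ s / (3 * Λ ^ 2) * 1 := by
        refine mul_le_mul_of_nonneg_left ?_ (by positivity)
        rw [div_le_one hz0]; exact hz
    _ = _ := mul_one _

lemma fluctuation_le (hL : 0 < L) (hΛ : 0 < Λ) (hs : 0 ≤ s) (hz : 1 ≤ z) :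
    fluctuation Λ s z ≤ fluctuation Λ s 1 := by
  have hanti : AntitoneOn (fluctuation Λ s) (Ioi 0) := by
    refine antitoneOn_of_deriv_nonpos (convex_Ioi 0) (fun z hz =>
      (hasDerivAt_fluctuation hL hΛ hs hz).continuousAt.continuousWithinAt) ?_ ?_ <;>
      rw [interior_Ioi]
    · exact fun z hz =>
        (hasDerivAt_fluctuation hL hΛ hs hz).differentiableAt.differentiableWithinAt
    · intro z hz
      rw [(hasDerivAt_fluctuation hL hΛ hs hz).deriv, neg_mul, neg_nonpos]
      exact mul_nonneg (mul_nonneg (Real.exp_pos _).le (response_nonneg hL hΛ hs hz))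
        (fluctuation_pos hΛ hs hz).le
  exact hanti (mem_Ioi.mpr one_pos) (mem_Ioi.mpr (by linarith)) hz

/-- `e^A E` satisfies a Riccati equation with leading coefficient one. -/
lemma IsResponse.hasDerivAt_exp_warp_mul {E : ℝ → ℝ} (hE : IsResponse L Λ s E) (hL : 0 < L)
    (hz : 0 < z) :
    HasDerivAt (fun z => Real.exp (warp L Λ z) * E z)
      ((Real.exp (warp L Λ z) * E z) ^ 2 -
        3 * deriv (warp L Λ) z * (Real.exp (warp L Λ z) * E z) - s) z := by
  obtain ⟨hd, he⟩ := hE z hz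
  have hA := (hasDerivAt_warp (Λ := Λ) hL hz).differentiableAt.hasDerivAt
  convert! hA.exp.mul hd.hasDerivAt using 1
  have hmul : Real.exp (warp L Λ z) * Real.exp (-warp L Λ z) = 1 := by
    rw [← Real.exp_add, add_neg_cancel, Real.exp_zero]
  linear_combination -Real.exp (warp L Λ z) * he + s * hmul

lemma false_of_one_le_deriv_of_le {f f' : ℝ → ℝ} {a C : ℝ}
    (hf : ∀ z, a ≤ z → HasDerivAt f (f' z) z) (hf' : ∀ z, a ≤ z → 1 ≤ f' z)
    (hC : ∀ z, a ≤ z → f z ≤ C) : False := by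
  have h := Convex.mul_sub_le_image_sub_of_le_deriv (convex_Ici a)
    (fun z hz => (hf z hz).continuousAt.continuousWithinAt)
    (fun z hz => (hf z (interior_subset hz)).differentiableAt.differentiableWithinAt) (C := 1)
    (fun z hz => by rw [(hf z (interior_subset hz)).deriv]; exact hf' z (interior_subset hz))
    a self_mem_Ici (a + |C - f a| + 1) (by simp only [mem_Ici]; linarith [abs_nonneg (C - f a)])
    (by linarith [abs_nonneg (C - f a)])
  have h2 := hC (a + |C - f a| + 1) (by linarith [abs_nonneg (C - f a)])
  have h3 := le_abs_self (C - f a)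
  linarith

/-- The infrared regular response function is unique. -/
lemma IsResponse.eq_response {E : ℝ → ℝ} (hE : IsResponse L Λ s E) (hreg : IsIRRegular L Λ E)
    (hL : 0 < L) (hΛ : 0 < Λ) (hs : 0 ≤ s) (hz : 0 < z) : E z = response L Λ s z := by
  obtain ⟨z₀, hz₀, C, hC⟩ := hreg
  set p : ℝ → ℝ := fun z => Real.exp (warp L Λ z) * response L Λ s z with hp
  set q : ℝ → ℝ := fun z => Real.exp (warp L Λ z) * E z with hq
  set U := fluctuation Λ s with hUdef
  have hp' : ∀ z, 0 < z → HasDerivAt p (p z ^ 2 - 3 * deriv (warp L Λ) z * p z - s) z :=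
    fun z hz => (isResponse_response hL hΛ hs).hasDerivAt_exp_warp_mul hL hz
  have hq' : ∀ z, 0 < z → HasDerivAt q (q z ^ 2 - 3 * deriv (warp L Λ) z * q z - s) z :=
    fun z hz => hE.hasDerivAt_exp_warp_mul hL hz
  have hU' : ∀ z, 0 < z → HasDerivAt U (-p z * U z) z :=
    fun z hz => hasDerivAt_fluctuation hL hΛ hs hz
  have hU0 : ∀ z, 0 < z → 0 < U z := fun z hz => fluctuation_pos hΛ hs hz
  have hqc : ContinuousOn q (Ioi 0) := fun z hz => (hq' z hz).continuousAt.continuousWithinAt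
  set φ : ℝ → ℝ := fun z => Real.exp (-(∫ t in z₀..z, q t)) with hφ
  have hφ0 : ∀ z, 0 < φ z := fun z => Real.exp_pos _
  have hφ' : ∀ z, 0 < z → HasDerivAt φ (-q z * φ z) z := by
    intro z hz
    have h1 : HasDerivAt (fun z => ∫ t in z₀..z, q t) (q z) z := by
      refine intervalIntegral.integral_hasDerivAt_right ?_ ?_ (hq' z hz).continuousAt
      · exact (hqc.mono fun t ht => lt_of_lt_of_le (lt_min hz₀ hz) ht.1).intervalIntegrable
      · exact hqc.stronglyMeasurableAtFilter isOpen_Ioi z hz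
    convert! h1.neg.exp using 1
    simp only [hφ, Pi.neg_apply]; ring
  have hφC : ∀ z, z₀ ≤ z → φ z ≤ Real.exp C := fun z hz => Real.exp_le_exp.mpr (hC z hz)
  -- `φ U (p - q)` is the Wronskian of the solutions `φ` and `U` of the linearised equation, so it
  -- is a constant multiple of `e^{-3A}`. The goal is that the constant vanishes.
  have hW' : ∀ z, 0 < z →
      HasDerivAt (fun z => φ z * U z * (p z - q z) * Real.exp (3 * warp L Λ z)) 0 z := by
    intro z hz
    have hA := (hasDerivAt_warp (Λ := Λ) hL hz).differentiableAt.hasDerivAt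
    convert! (((hφ' z hz).mul (hU' z hz)).mul ((hp' z hz).sub (hq' z hz))).mul
      (hA.const_mul 3).exp using 1
    simp only [Pi.mul_apply, Pi.sub_apply]
    ring
  set c := φ 1 * U 1 * (p 1 - q 1) * Real.exp (3 * warp L Λ 1) with hc
  have hW : ∀ z, 0 < z → φ z * U z * (p z - q z) = c * Real.exp (-(3 * warp L Λ z)) := by
    intro z hz
    have := isOpen_Ioi.is_const_of_deriv_eq_zero isPreconnected_Ioi
      (fun z hz => (hW' z hz).differentiableAt.differentiableWithinAt)
      (fun z hz => (hW' z hz).deriv) (mem_Ioi.mpr hz) (mem_Ioi.mpr one_pos)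
    rw [hc, ← this, mul_assoc _ (Real.exp _) (Real.exp _), ← Real.exp_add, add_neg_cancel,
      Real.exp_zero, mul_one]
  have hgrow := tendsto_exp_neg_three_warp (Λ := Λ) hL
  have hUle : ∀ z, 1 ≤ z → U z ≤ U 1 := fun z hz => fluctuation_le hL hΛ hs hz
  have hU1 := hU0 1 one_pos
  have hc0 : c = 0 := by
    rcases lt_trichotomy c 0 with hneg | h0 | hpos
    -- Here `(φ/U)' = c e^{-3A}/U²` tends to `-∞`, since `U` is bounded; this contradicts `φ/U > 0`.
    · exfalso
      obtain ⟨z₁, hz₁⟩ := eventually_atTop.mp (hgrow.eventually_ge_atTop (U 1 ^ 2 / (-c)))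
      refine false_of_one_le_deriv_of_le (f := fun z => -(φ z / U z)) (a := max z₁ 1) (C := 0)
        (fun z hz => ((hφ' z (by linarith [le_max_right z₁ 1])).div
          (hU' z (by linarith [le_max_right z₁ 1])) (hU0 z
            (by linarith [le_max_right z₁ 1])).ne').neg) ?_ ?_
      · intro z hz
        have hz1 : 1 ≤ z := (le_max_right z₁ 1).trans hz
        have hz0 : 0 < z := by linarith
        have h1 := hz₁ z ((le_max_left z₁ 1).trans hz)
        rw [div_le_iff₀ (by linarith)] at h1
        have h2 := hW z hz0
        have h3 : U z ^ 2 ≤ U 1 ^ 2 := pow_le_pow_left₀ (hU0 z hz0).le (hUle z hz1) 2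
        have e : -((-q z * φ z * U z - φ z * (-p z * U z)) / U z ^ 2) =
            (-(c * Real.exp (-(3 * warp L Λ z)))) / U z ^ 2 := by
          rw [← h2]; ring
        rw [e, le_div_iff₀ (pow_pos (hU0 z hz0) 2)]
        linarith
      · intro z hz
        have hz0 : 0 < z := by linarith [le_max_right z₁ 1]
        simp only [Left.neg_nonpos_iff]
        exact (div_pos (hφ0 z) (hU0 z hz0)).le
    · exact h0
    -- Here `φ' U = c e^{-3A} - p U φ`, where `p U ≤ B` and regularity gives `φ ≤ e^C`. So
    -- eventually `φ' ≥ 1`, against that same bound on `φ`.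
    · exfalso
      set B := s / (3 * Λ ^ 2) with hB
      have hB0 : 0 ≤ B := by positivity
      obtain ⟨z₁, hz₁⟩ := eventually_atTop.mp
        (hgrow.eventually_ge_atTop ((U 1 + B * Real.exp C) / c))
      refine false_of_one_le_deriv_of_le (f := φ) (a := max z₁ (max 1 z₀)) (C := Real.exp C)
        (fun z hz => hφ' z (lt_of_lt_of_le hz₀
          ((le_max_right _ _).trans ((le_max_right _ _).trans hz)))) ?_
        (fun z hz => hφC z ((le_max_right _ _).trans ((le_max_right _ _).trans hz)))
      intro z hz
      have hz1 : 1 ≤ z := (le_max_left _ _).trans ((le_max_right _ _).trans hz)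
      have hzz : z₀ ≤ z := (le_max_right _ _).trans ((le_max_right _ _).trans hz)
      have hz0 : 0 < z := by linarith
      have h1 := hz₁ z ((le_max_left _ _).trans hz)
      rw [div_le_iff₀ hpos] at h1
      have h2 := hW z hz0
      have h3 : p z * U z ≤ B := exp_warp_mul_response_mul_fluctuation_le hL hΛ hs hz1
      have h4 : p z * U z * φ z ≤ B * Real.exp C :=
        mul_le_mul h3 (hφC z hzz) (hφ0 z).le hB0
      have h5 := hUle z hz1
      have h6 : 1 * U z ≤ (-q z * φ z) * U z := by nlinarith
      exact le_of_mul_le_mul_right h6 (hU0 z hz0)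
  have h := hW z hz
  rw [hc0, zero_mul] at h
  have hpq : p z - q z = 0 :=
    (mul_eq_zero.mp h).resolve_left (mul_pos (hφ0 z) (hU0 z hz)).ne'
  have : Real.exp (warp L Λ z) * (response L Λ s z - E z) = 0 := by
    rw [mul_sub]; exact hpq
  rcases mul_eq_zero.mp this with h | h
  · exact absurd h (Real.exp_pos _).ne'
  · linarith

end response

/-! ### The renormalized response function. -/

/-- The renormalized response function. -/
def renormalizedResponse (L Λ μ s : ℝ) : ℝ :=
  s / (2 * L) * (-2 * Λ ^ 2 + 3 * Λ ^ 2 / 2 * (s / (6 * Λ ^ 2) + 1) *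
    (Real.log (3 * Λ ^ 2 / 2 / μ ^ 2) - kummerConst + harmonicShift (s / (6 * Λ ^ 2))))

/-- The expansion of `kummerR` with the exponential prefactors of the response function. -/
lemma tendsto_exp_mul_kummerR_sub {a c : ℝ} (ha : 0 ≤ a) :
    Tendsto (fun u => Real.exp (u / 3) * (kummerR a u - Real.exp (u / 3)) / u -
      (a + 1) * (Real.log u - c)) (𝓝[>] 0)
      (𝓝 (-(4 / 3) + (a + 1) * (c - kummerConst + harmonicShift a))) := by
  have hX : Tendsto (fun u : ℝ => Real.exp (u / 3)) (𝓝[>] 0) (𝓝 1) := by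
    have : Tendsto (fun u : ℝ => Real.exp (u / 3)) (𝓝 0) (𝓝 (Real.exp (0 / 3))) :=
      Continuous.tendsto (by fun_prop) 0
    simpa using this.mono_left nhdsWithin_le_nhds
  have hX1 : Tendsto (fun u : ℝ => (Real.exp (u / 3) - 1) / u) (𝓝[>] 0) (𝓝 (1 / 3)) := by
    have h : HasDerivAt (fun u : ℝ => Real.exp (u / 3)) (1 / 3) 0 := by
      simpa using ((hasDerivAt_id (0 : ℝ)).div_const 3).exp
    have := h.tendsto_slope_zero_right
    refine this.congr fun u => ?_
    simp [div_eq_inv_mul]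
  have hlog : Tendsto (fun u : ℝ => u * Real.log u) (𝓝[>] 0) (𝓝 0) := by
    simpa [mul_comm] using tendsto_log_mul_rpow_nhdsGT_zero (show (0 : ℝ) < 1 by norm_num)
  have key := ((hX.mul (((tendsto_kummerR ha).sub_const 1).sub hX1)).add
    ((hX1.mul hlog).const_mul (a + 1))).add_const ((a + 1) * c)
  refine (key.congr' ?_).trans_eq ?_
  · filter_upwards [self_mem_nhdsWithin] with u (hu : 0 < u)
    field_simp
    ring
  · congr 1
    ring

/-- With `X = e^{u/3}`, where `u/3 = Λ²z²/2`, the leading local term is `(s/2) z² X²`, so the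
difference to expand is `(s/2) z² X (R - X)`. The constant `c = log(3Λ²/(2μ²))` converts `log u - c`
into `log(z²μ²)`. -/
lemma tendsto_response_sub_uvLocal {L Λ μ s : ℝ} (hL : 0 < L) (hΛ : 0 < Λ) (hμ : 0 < μ)
    (hs : 0 ≤ s) :
    Tendsto (fun z => (L * response L Λ s z - uvLocal L Λ μ s z) / z ^ 4) (𝓝[>] 0)
      (𝓝 (L * renormalizedResponse L Λ μ s)) := by
  have hκ : 0 < 3 * Λ ^ 2 / 2 := by positivity
  have hu : Tendsto (fun z : ℝ => 3 * Λ ^ 2 / 2 * z ^ 2) (𝓝[>] 0) (𝓝[>] 0) := by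
    refine tendsto_nhdsWithin_iff.mpr ⟨?_, ?_⟩
    · have : Tendsto (fun z : ℝ => 3 * Λ ^ 2 / 2 * z ^ 2) (𝓝 0) (𝓝 (3 * Λ ^ 2 / 2 * 0 ^ 2)) :=
        Continuous.tendsto (by fun_prop) 0
      simpa using this.mono_left nhdsWithin_le_nhds
    · filter_upwards [self_mem_nhdsWithin] with z (hz : 0 < z)
      exact mem_Ioi.mpr (by positivity)
  have ha : 0 ≤ s / (6 * Λ ^ 2) := by positivity
  have key := ((tendsto_exp_mul_kummerR_sub (c := Real.log (3 * Λ ^ 2 / 2 / μ ^ 2)) ha).comp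
    hu).const_mul (s / 2 * (3 * Λ ^ 2 / 2))
  refine (key.congr' ?_).trans_eq ?_
  · filter_upwards [self_mem_nhdsWithin] with z (hz : 0 < z)
    have e1 : Real.log (3 * Λ ^ 2 / 2 * z ^ 2) - Real.log (3 * Λ ^ 2 / 2 / μ ^ 2) =
        Real.log (z ^ 2 * μ ^ 2) := by
      rw [← Real.log_div (by positivity) (by positivity)]
      congr 1
      field_simp
    have e2 : Real.exp (-2 * warp L Λ z) = (z / L * Real.exp (Λ ^ 2 * z ^ 2 / 2)) ^ 2 := by
      rw [← exp_neg_warp hL hz, ← Real.exp_nat_mul]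
      push_cast
      ring_nf
    simp only [Function.comp_apply]
    rw [e1, uvLocal, e2, response,
      show 3 * Λ ^ 2 / 2 * z ^ 2 / 3 = Λ ^ 2 * z ^ 2 / 2 by ring]
    generalize kummerR (s / (6 * Λ ^ 2)) (3 * Λ ^ 2 / 2 * z ^ 2) = R
    generalize Real.exp (Λ ^ 2 * z ^ 2 / 2) = X
    generalize Real.log (z ^ 2 * μ ^ 2) = l
    field_simp
    ring
  · congr 1
    unfold renormalizedResponse
    generalize harmonicShift (s / (6 * Λ ^ 2)) = D
    generalize Real.log (3 * Λ ^ 2 / 2 / μ ^ 2) = l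
    field_simp
    ring

lemma isRenormalizedResponse_iff {L Λ μ s e : ℝ} (hL : 0 < L) (hΛ : 0 < Λ) (hμ : 0 < μ)
    (hs : 0 ≤ s) :
    IsRenormalizedResponse L Λ μ s e ↔ e = renormalizedResponse L Λ μ s := by
  have ht := tendsto_response_sub_uvLocal hL hΛ hμ hs
  constructor
  · rintro ⟨E, hE, hreg, hlim⟩
    have h : Tendsto (fun z => (L * E z - uvLocal L Λ μ s z) / z ^ 4) (𝓝[>] 0)
        (𝓝 (L * renormalizedResponse L Λ μ s)) := by
      refine ht.congr' ?_
      filter_upwards [self_mem_nhdsWithin] with z hz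
      rw [hE.eq_response hreg hL hΛ hs hz]
    exact mul_left_cancel₀ hL.ne' (tendsto_nhds_unique hlim h)
  · rintro rfl
    exact ⟨_, isResponse_response hL hΛ hs, isIRRegular_response hL hΛ hs, ht⟩

/-! ### The Bessel function `K₁`: bounds, Schwinger integral, asymptotics. -/

lemma cosh_eq_one_add (t : ℝ) : Real.cosh t = 1 + 2 * Real.sinh (t / 2) ^ 2 := by
  have h := Real.cosh_two_mul (t / 2)
  rw [mul_div_cancel₀ t two_ne_zero, Real.cosh_sq] at h
  linarith

lemma one_add_sq_div_two_le_cosh (t : ℝ) : 1 + t ^ 2 / 2 ≤ Real.cosh t := by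
  have h1 : |t / 2| ≤ |Real.sinh (t / 2)| := by
    rw [Real.abs_sinh]
    exact Real.self_le_sinh_iff.mpr (abs_nonneg _)
  have h2 := sq_le_sq.mpr h1
  rw [cosh_eq_one_add]
  nlinarith

lemma exp_neg_mul_cosh_mul_cosh_le {y : ℝ} (hy : 0 < y) (t : ℝ) :
    Real.exp (-(y * Real.cosh t)) * Real.cosh t ≤ 4 / y ^ 2 * (1 + t ^ 2)⁻¹ := by
  have hc := Real.cosh_pos t
  have h1 := Real.quadratic_le_exp_of_nonneg (show 0 ≤ y * Real.cosh t by positivity)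
  have h2 : (y * Real.cosh t) ^ 2 / 2 ≤ Real.exp (y * Real.cosh t) := by
    have : 0 < y * Real.cosh t := by positivity
    linarith
  have h3 : Real.exp (-(y * Real.cosh t)) ≤ 2 / (y * Real.cosh t) ^ 2 := by
    rw [Real.exp_neg, inv_le_comm₀ (Real.exp_pos _) (by positivity), inv_div]
    exact h2
  calc _ ≤ 2 / (y * Real.cosh t) ^ 2 * Real.cosh t := mul_le_mul_of_nonneg_right h3 hc.le
    _ = 4 / y ^ 2 * (2 * Real.cosh t)⁻¹ := by field_simp; norm_num
    _ ≤ _ := by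
      refine mul_le_mul_of_nonneg_left (inv_anti₀ (by positivity) ?_) (by positivity)
      nlinarith [one_add_sq_div_two_le_cosh t]

lemma integrable_exp_neg_mul_cosh_mul_cosh {y : ℝ} (hy : 0 < y) :
    Integrable fun t : ℝ => Real.exp (-(y * Real.cosh t)) * Real.cosh t := by
  refine Integrable.mono' (integrable_inv_one_add_sq.const_mul (4 / y ^ 2))
    (Continuous.aestronglyMeasurable (by fun_prop)) (Eventually.of_forall fun t => ?_)
  rw [Real.norm_eq_abs, abs_of_pos (mul_pos (Real.exp_pos _) (Real.cosh_pos t))]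
  exact exp_neg_mul_cosh_mul_cosh_le hy t

lemma besselK_one_eq (y : ℝ) : besselK 1 y =
    ∫ t in Ioi (0 : ℝ), Real.exp (-(y * Real.cosh t)) * Real.cosh t := by
  simp [besselK]

lemma besselK_one_nonneg (y : ℝ) : 0 ≤ besselK 1 y := by
  rw [besselK_one_eq]
  exact integral_nonneg fun t => (mul_pos (Real.exp_pos _) (Real.cosh_pos t)).le

/-- `cosh t ≥ 1` lets `e^{-(y - y')}` be pulled out of the integrand. This one bound yields
monotonicity, summability and the tail estimate. -/
lemma besselK_one_le {y y' : ℝ} (hy' : 0 < y') (h : y' ≤ y) :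
    besselK 1 y ≤ Real.exp (-(y - y')) * besselK 1 y' := by
  rw [besselK_one_eq, besselK_one_eq, ← integral_const_mul]
  refine integral_mono (integrable_exp_neg_mul_cosh_mul_cosh (hy'.trans_le h)).integrableOn
    ((integrable_exp_neg_mul_cosh_mul_cosh hy').integrableOn.const_mul _) fun t => ?_
  simp only
  rw [← mul_assoc, ← Real.exp_add]
  refine mul_le_mul_of_nonneg_right (Real.exp_le_exp.mpr ?_) (Real.cosh_pos t).le
  nlinarith [Real.one_le_cosh t]

lemma integrable_exp_neg_mul_exp_neg_mul_cosh {y : ℝ} (hy : 0 < y) :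
    Integrable fun t : ℝ => Real.exp (-t) * Real.exp (-(y * Real.cosh t)) := by
  refine Integrable.mono' ((integrable_exp_neg_mul_cosh_mul_cosh hy).const_mul 2)
    (Continuous.aestronglyMeasurable (by fun_prop)) (Eventually.of_forall fun t => ?_)
  rw [Real.norm_eq_abs, abs_of_pos (mul_pos (Real.exp_pos _) (Real.exp_pos _)), Real.cosh_eq]
  nlinarith [mul_pos (Real.exp_pos (-(y * ((Real.exp t + Real.exp (-t)) / 2)))) (Real.exp_pos t)]

/-- Folding the line at `0` symmetrises `e^{-t}` into `2 cosh t`. -/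
lemma integral_exp_neg_mul_exp_neg_mul_cosh {y : ℝ} (hy : 0 < y) :
    ∫ t : ℝ, Real.exp (-t) * Real.exp (-(y * Real.cosh t)) = 2 * besselK 1 y := by
  have hi := integrable_exp_neg_mul_exp_neg_mul_cosh hy
  have h1 := integral_comp_neg_Iic 0 fun t => Real.exp t * Real.exp (-(y * Real.cosh t))
  simp only [Real.cosh_neg, neg_zero] at h1
  have hi2 : IntegrableOn (fun t : ℝ => Real.exp t * Real.exp (-(y * Real.cosh t))) (Ioi 0) := by
    have := hi.comp_neg
    simp only [neg_neg, Real.cosh_neg] at this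
    exact this.integrableOn
  rw [← intervalIntegral.integral_Iic_add_Ioi hi.integrableOn hi.integrableOn, h1,
    ← integral_add hi2 hi.integrableOn, besselK_one_eq, ← integral_const_mul]
  refine setIntegral_congr_fun measurableSet_Ioi fun t _ => ?_
  simp only [Real.cosh_eq]
  ring

lemma image_const_mul_exp {c : ℝ} (hc : 0 < c) :
    (fun t => c * Real.exp t) '' univ = Ioi 0 := by
  ext x
  simp only [image_univ, mem_range, mem_Ioi]
  refine ⟨?_, fun hx => ⟨Real.log (x / c), ?_⟩⟩
  · rintro ⟨t, rfl⟩
    positivity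
  · rw [Real.exp_log (div_pos hx hc), mul_div_cancel₀ x hc.ne']

/-- The Schwinger parametrisation of the Bessel function. -/
lemma integral_heat_kernel {m r : ℝ} (hm : 0 < m) (hr : 0 < r) :
    IntegrableOn (fun τ => Real.exp (-(m ^ 2 * τ)) *
      ((Real.pi / τ) ^ 2 * Real.exp (-(r ^ 2 / (4 * τ))))) (Ioi 0) ∧
    ∫ τ in Ioi (0 : ℝ), Real.exp (-(m ^ 2 * τ)) *
      ((Real.pi / τ) ^ 2 * Real.exp (-(r ^ 2 / (4 * τ)))) =
      4 * Real.pi ^ 2 * m ^ 2 * (besselK 1 (m * r) / (m * r)) := by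
  set g : ℝ → ℝ := fun τ => Real.exp (-(m ^ 2 * τ)) *
      ((Real.pi / τ) ^ 2 * Real.exp (-(r ^ 2 / (4 * τ)))) with hg
  -- `τ = c e^t` with this `c` balances `m²τ` against `r²/(4τ)`: their sum becomes `m r cosh t`.
  set c := r / (2 * m) with hc
  have hc0 : 0 < c := by positivity
  have hf' : ∀ x ∈ (univ : Set ℝ), HasDerivWithinAt (fun t => c * Real.exp t) (c * Real.exp x)
      univ x := fun x _ => ((Real.hasDerivAt_exp x).const_mul c).hasDerivWithinAt
  have hinj : InjOn (fun t => c * Real.exp t) univ := fun s _ t _ h =>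
    Real.exp_injective (mul_left_cancel₀ hc0.ne' h)
  have e : ∀ t : ℝ, |c * Real.exp t| • g (c * Real.exp t) =
      Real.pi ^ 2 / c * (Real.exp (-t) * Real.exp (-(m * r * Real.cosh t))) := by
    intro t
    have hx := Real.exp_pos t
    rw [abs_of_pos (by positivity), smul_eq_mul, hg]
    have h1 : Real.exp (-(m * r * Real.cosh t)) =
        Real.exp (-(m ^ 2 * (c * Real.exp t))) * Real.exp (-(r ^ 2 / (4 * (c * Real.exp t)))) := by
      rw [← Real.exp_add, Real.cosh_eq, Real.exp_neg t, hc]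
      congr 1
      field_simp
      ring
    rw [h1, Real.exp_neg t]
    simp only
    field_simp
  have himg := image_const_mul_exp hc0
  constructor
  · rw [← himg, integrableOn_image_iff_integrableOn_abs_deriv_smul MeasurableSet.univ hf' hinj]
    simp only [e]
    exact ((integrable_exp_neg_mul_exp_neg_mul_cosh (mul_pos hm hr)).const_mul _).integrableOn
  · change ∫ τ in Ioi (0 : ℝ), g τ = _
    rw [← himg, integral_image_eq_integral_abs_deriv_smul MeasurableSet.univ hf' hinj]
    simp only [e]
    rw [setIntegral_univ, integral_const_mul,
      integral_exp_neg_mul_exp_neg_mul_cosh (mul_pos hm hr), hc]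
    field_simp
    ring

/-- The leading asymptotics of `K₁` at infinity. -/
lemma tendsto_sqrt_mul_exp_mul_besselK_one :
    Tendsto (fun y => √y * Real.exp y * besselK 1 y) atTop (𝓝 √(Real.pi / 2)) := by
  have hlim : ∫ r in Ioi (0 : ℝ), Real.exp (-(r ^ 2 / 2)) = √(Real.pi / 2) := by
    have h := integral_gaussian_Ioi (1 / 2)
    have e : √(Real.pi / (1 / 2)) / 2 = √(Real.pi / 2) := by
      rw [show Real.pi / (1 / 2) = 2 ^ 2 * (Real.pi / 2) by ring, Real.sqrt_mul (by positivity),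
        Real.sqrt_sq (by norm_num)]
      ring
    rw [← e, ← h]
    refine integral_congr_ae (Eventually.of_forall fun r => ?_)
    simp only
    ring_nf
  -- Laplace's method: rescale `t = r/√y` about the minimum of `cosh` at `0`.
  have hform : ∀ y : ℝ, 0 < y → √y * Real.exp y * besselK 1 y =
      ∫ r in Ioi (0 : ℝ), Real.exp (-(y * (Real.cosh ((√y)⁻¹ * r) - 1))) *
        Real.cosh ((√y)⁻¹ * r) := by
    intro y hy
    have hs := Real.sqrt_pos.mpr hy
    have h := integral_comp_mul_left_Ioi
      (fun t => Real.exp (-(y * (Real.cosh t - 1))) * Real.cosh t) 0 (inv_pos.mpr hs)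
    rw [h, mul_zero, inv_inv, smul_eq_mul, besselK_one_eq, mul_assoc, ← integral_const_mul]
    congr 1
    refine integral_congr_ae (Eventually.of_forall fun t => ?_)
    simp only
    rw [← mul_assoc, ← Real.exp_add]
    ring_nf
  rw [← hlim]
  refine Tendsto.congr' (f₁ := fun y => ∫ r in Ioi (0 : ℝ),
    Real.exp (-(y * (Real.cosh ((√y)⁻¹ * r) - 1))) * Real.cosh ((√y)⁻¹ * r)) ?_ ?_
  · filter_upwards [eventually_gt_atTop 0] with y hy
    exact (hform y hy).symm
  have hε : Tendsto (fun y : ℝ => (√y)⁻¹) atTop (𝓝[>] 0) := by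
    refine tendsto_nhdsWithin_iff.mpr
      ⟨tendsto_inv_atTop_zero.comp Real.tendsto_sqrt_atTop, ?_⟩
    filter_upwards [eventually_gt_atTop 0] with y hy
    exact inv_pos.mpr (Real.sqrt_pos.mpr hy)
  -- With `d = cosh(r/√y) - 1`, `y d ≥ r²/2` and `cosh ≤ e^d`; for `y ≥ 2` the exponent `-(y - 1)d`
  -- is at most `-yd/2 ≤ -r²/4`.
  refine tendsto_integral_filter_of_dominated_convergence
    (fun r => Real.exp (-(1 / 4) * r ^ 2)) ?_ ?_ ?_ ?_
  · exact Eventually.of_forall fun y => Continuous.aestronglyMeasurable (by fun_prop)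
  · filter_upwards [eventually_ge_atTop 2] with y hy
    refine Eventually.of_forall fun r => ?_
    have hs : 0 < √y := Real.sqrt_pos.mpr (by linarith)
    set d := Real.cosh ((√y)⁻¹ * r) - 1 with hd
    have hc : Real.cosh ((√y)⁻¹ * r) = d + 1 := by rw [hd]; ring
    have h1 : r ^ 2 / (2 * y) ≤ d := by
      have := one_add_sq_div_two_le_cosh ((√y)⁻¹ * r)
      rw [mul_pow, inv_pow, Real.sq_sqrt (by linarith)] at this
      have e : r ^ 2 / (2 * y) = y⁻¹ * r ^ 2 / 2 := by field_simp
      rw [e, hd]; linarith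
    have hd0 : 0 ≤ d := le_trans (by positivity) h1
    have h2 : r ^ 2 / 2 ≤ y * d := by
      have := mul_le_mul_of_nonneg_left h1 (show 0 ≤ y by linarith)
      have e : y * (r ^ 2 / (2 * y)) = r ^ 2 / 2 := by field_simp
      rwa [e] at this
    rw [Real.norm_eq_abs, abs_of_nonneg (mul_nonneg (Real.exp_pos _).le (Real.cosh_pos _).le), hc]
    calc _ ≤ Real.exp (-(y * d)) * Real.exp d :=
          mul_le_mul_of_nonneg_left (Real.add_one_le_exp d) (Real.exp_pos _).le
      _ = Real.exp (-(y * d) + d) := (Real.exp_add _ _).symm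
      _ ≤ _ := Real.exp_le_exp.mpr (by nlinarith)
  · exact (integrable_exp_neg_mul_sq (by norm_num)).integrableOn
  · refine Eventually.of_forall fun r => ?_
    have hder : HasDerivAt (fun x : ℝ => Real.sinh (x * (r / 2))) (r / 2) 0 := by
      simpa using ((hasDerivAt_id (0 : ℝ)).mul_const (r / 2)).sinh
    have h1 := hder.tendsto_slope_zero_right.comp hε
    have h2 : Tendsto (fun y : ℝ => y * (Real.cosh ((√y)⁻¹ * r) - 1)) atTop
        (𝓝 (2 * (r / 2) ^ 2)) := by
      refine ((h1.pow 2).const_mul 2).congr' ?_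
      filter_upwards [eventually_gt_atTop 0] with y hy
      simp only [Function.comp_apply, zero_add, zero_mul, Real.sinh_zero, sub_zero, inv_inv,
        smul_eq_mul]
      rw [cosh_eq_one_add, mul_pow, Real.sq_sqrt hy.le, mul_div_assoc]
      ring
    have h3 : Tendsto (fun y : ℝ => Real.cosh ((√y)⁻¹ * r)) atTop (𝓝 1) := by
      have := (Real.continuous_cosh.tendsto (0 * r)).comp
        ((tendsto_nhds_of_tendsto_nhdsWithin hε).mul_const r)
      simpa [Function.comp_def] using this
    have h4 := (Real.continuous_exp.tendsto _).comp h2.neg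
    convert! h4.mul h3 using 2
    ring_nf

/-! ### Convergence and large distance behaviour of the series. -/

/-- Only the product `Λx` enters, whence the uniformity in `Λ` of the asymptotics. -/
lemma seriesTerm_eq (Λ x : ℝ) (n : ℕ) : seriesTerm Λ x n = seriesTerm 1 (Λ * x) n := by
  simp only [seriesTerm, mul_one, mul_assoc]

lemma seriesTerm_nonneg {Λ x : ℝ} (hΛ : 0 < Λ) (hx : 0 < x) (n : ℕ) : 0 ≤ seriesTerm Λ x n := by
  have := besselK_one_nonneg (Real.sqrt (6 * ((n : ℝ) + 2)) * Λ * x)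
  unfold seriesTerm
  positivity

/-- Used with `b = 0` for monotonicity in `x`, and with `b = √18` for the terms beyond the first. -/
lemma seriesTerm_le {b x y : ℝ} {n : ℕ} (hx : 0 < x) (hxy : x ≤ y)
    (hn : b ≤ √(6 * ((n : ℝ) + 2))) :
    seriesTerm 1 y n ≤ Real.exp (-(b * (y - x))) * seriesTerm 1 x n := by
  set c := √(6 * ((n : ℝ) + 2)) with hc
  have hc0 : 0 < c := Real.sqrt_pos.mpr (by positivity)
  have hcx : 0 < c * x := mul_pos hc0 hx
  have hcxy : c * x ≤ c * y := mul_le_mul_of_nonneg_left hxy hc0.le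
  simp only [seriesTerm, mul_one, ← hc]
  rw [mul_left_comm (Real.exp _)]
  refine mul_le_mul_of_nonneg_left ?_ (by positivity)
  rw [mul_div_assoc']
  refine div_le_div₀ (mul_nonneg (Real.exp_pos _).le (besselK_one_nonneg _)) ?_ hcx hcxy
  refine (besselK_one_le hcx hcxy).trans (mul_le_mul_of_nonneg_right
    (Real.exp_le_exp.mpr ?_) (besselK_one_nonneg _))
  nlinarith

lemma seriesTerm_anti {Λ x y : ℝ} (hΛ : 0 < Λ) (hx : 0 < x) (hxy : x ≤ y) (n : ℕ) :
    seriesTerm Λ y n ≤ seriesTerm Λ x n := by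
  rw [seriesTerm_eq Λ y, seriesTerm_eq Λ x]
  simpa using seriesTerm_le (b := 0) (mul_pos hΛ hx) (mul_le_mul_of_nonneg_left hxy hΛ.le)
    (Real.sqrt_nonneg (6 * ((n : ℝ) + 2)))

/-- `K₁(cX)` decays like `e^{-cX} ≤ 10!/(cX)^10`, and `c² = 6(n + 2)`, so this power supplies `(n +
2)^{-5}`: enough to beat the cubic coefficient and leave `1/(n + 1)²`. -/
lemma summable_seriesTerm {Λ x : ℝ} (hΛ : 0 < Λ) (hx : 0 < x) : Summable (seriesTerm Λ x) := by
  have hX : 0 < Λ * x := mul_pos hΛ hx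
  simp only [funext (seriesTerm_eq Λ x)]
  generalize Λ * x = X at hX
  have hmain : ∀ n : ℕ, seriesTerm 1 X n ≤
      Real.exp X * besselK 1 X / X * (Nat.factorial 10 / (6 * X ^ 2) ^ 5) *
        (1 / ((n : ℝ) + 1) ^ 2) := by
    intro n
    have hn : (0 : ℝ) ≤ n := n.cast_nonneg
    simp only [seriesTerm, mul_one]
    set c := √(6 * ((n : ℝ) + 2)) with hc
    have hc0 : 0 < c := Real.sqrt_pos.mpr (by positivity)
    have hc1 : 1 ≤ c := Real.one_le_sqrt.mpr (by linarith)
    have hc2 : c ^ 2 = 6 * ((n : ℝ) + 2) := Real.sq_sqrt (by positivity)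
    have hcX : X ≤ c * X := le_mul_of_one_le_left hX.le hc1
    have h1 := besselK_one_le hX hcX
    have h2 : Real.exp (-(c * X)) ≤ Nat.factorial 10 / (c * X) ^ 10 := by
      have := Real.pow_div_factorial_le_exp (c * X) (by positivity) 10
      rw [Real.exp_neg, inv_le_comm₀ (Real.exp_pos _) (by positivity), inv_div]
      exact this
    have h3 : (c * X) ^ 10 = (6 * X ^ 2) ^ 5 * ((n : ℝ) + 2) ^ 5 := by
      calc (c * X) ^ 10 = (c ^ 2) ^ 5 * X ^ 10 := by ring
        _ = _ := by rw [hc2]; ring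
    have h4 : besselK 1 (c * X) / (c * X) ≤
        Real.exp X * besselK 1 X / X * (Nat.factorial 10 / (c * X) ^ 10) := by
      have hK := besselK_one_nonneg X
      calc _ ≤ (Real.exp (-(c * X - X)) * besselK 1 X) / X :=
            div_le_div₀ (mul_nonneg (Real.exp_pos _).le hK) h1 hX hcX
        _ = Real.exp X * besselK 1 X / X * Real.exp (-(c * X)) := by
            rw [show -(c * X - X) = X + -(c * X) by ring, Real.exp_add]; ring
        _ ≤ _ := mul_le_mul_of_nonneg_left h2
            (div_nonneg (mul_nonneg (Real.exp_pos _).le hK) hX.le)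
    have hA : 0 ≤ Real.exp X * besselK 1 X / X * (Nat.factorial 10 / (6 * X ^ 2) ^ 5) := by
      have hK := besselK_one_nonneg X
      positivity
    calc _ ≤ ((n : ℝ) + 1) * ((n : ℝ) + 2) ^ 2 *
          (Real.exp X * besselK 1 X / X * (Nat.factorial 10 / (c * X) ^ 10)) :=
          mul_le_mul_of_nonneg_left h4 (by positivity)
      _ = Real.exp X * besselK 1 X / X * (Nat.factorial 10 / (6 * X ^ 2) ^ 5) *
          (((n : ℝ) + 1) * ((n : ℝ) + 2) ^ 2 / ((n : ℝ) + 2) ^ 5) := by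
          rw [h3]
          field_simp
      _ ≤ _ := by
          refine mul_le_mul_of_nonneg_left ?_ hA
          rw [div_le_div_iff₀ (by positivity) (by positivity), one_mul]
          have : ((n : ℝ) + 1) ^ 3 ≤ ((n : ℝ) + 2) ^ 3 :=
            pow_le_pow_left₀ (by positivity) (by linarith) 3
          calc _ = ((n : ℝ) + 1) ^ 3 * ((n : ℝ) + 2) ^ 2 := by ring
            _ ≤ ((n : ℝ) + 2) ^ 3 * ((n : ℝ) + 2) ^ 2 :=
              mul_le_mul_of_nonneg_right this (by positivity)
            _ = _ := by ring
  refine Summable.of_nonneg_of_le (fun n => seriesTerm_nonneg one_pos hX n) hmain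
    (summable_one_div_succ_sq.mul_left _)

/-- The leading behaviour of the series at large argument. -/
def leadingTerm (X : ℝ) : ℝ :=
  4 * √(Real.pi / 2) * (Real.exp (-(2 * √3 * X)) / (2 * √3 * X) ^ (3 / 2 : ℝ))

lemma leadingTerm_pos {X : ℝ} (hX : 0 < X) : 0 < leadingTerm X := by
  have := Real.pi_pos
  unfold leadingTerm
  positivity

lemma tendsto_seriesTerm_zero_div_leadingTerm :
    Tendsto (fun X => seriesTerm 1 X 0 / leadingTerm X) atTop (𝓝 1) := by
  have hc : (0 : ℝ) < √(Real.pi / 2) := Real.sqrt_pos.mpr (by have := Real.pi_pos; positivity)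
  have h3 : (0 : ℝ) < 2 * √3 := by positivity
  have h := (tendsto_sqrt_mul_exp_mul_besselK_one.comp
    (tendsto_id.const_mul_atTop h3)).div_const (√(Real.pi / 2))
  rw [div_self hc.ne'] at h
  refine h.congr' ?_
  filter_upwards [eventually_gt_atTop 0] with X hX
  have hs : √(6 * (((0 : ℕ) : ℝ) + 2)) = 2 * √3 := by
    rw [show (6 * (((0 : ℕ) : ℝ) + 2)) = 2 ^ 2 * 3 by norm_num,
      Real.sqrt_mul (by positivity), Real.sqrt_sq (by norm_num)]
  simp only [seriesTerm, leadingTerm, Function.comp_apply, id, hs, mul_one]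
  have hy : 0 < 2 * √3 * X := by positivity
  generalize 2 * √3 * X = y at hy
  have hy3 : y ^ (3 / 2 : ℝ) = y * √y := by
    rw [show (3 / 2 : ℝ) = 1 + 1 / 2 by norm_num, Real.rpow_add hy, Real.rpow_one,
      Real.sqrt_eq_rpow]
  rw [hy3, Real.exp_neg]
  have := Real.sqrt_pos.mpr hy
  push_cast
  field_simp
  norm_num

/-- The second mass is strictly larger than the first, `√18 > √12 = 2√3`, so the exponential gap
beats the power `X^(3/2)`. -/
lemma tendsto_tail_div_leadingTerm (T : ℝ) :
    Tendsto (fun X => Real.exp (-(√18 * (X - 1))) * T / leadingTerm X) atTop (𝓝 0) := by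
  have hδ : 0 < √18 - 2 * √3 := by
    have : 2 * √3 = √12 := by
      rw [show (12 : ℝ) = 2 ^ 2 * 3 by norm_num, Real.sqrt_mul (by positivity),
        Real.sqrt_sq (by norm_num)]
    rw [this, sub_pos]
    exact Real.sqrt_lt_sqrt (by norm_num) (by norm_num)
  have h := (tendsto_rpow_mul_exp_neg_mul_atTop_nhds_zero (3 / 2) _ hδ).const_mul
    (T * Real.exp √18 * (2 * √3) ^ (3 / 2 : ℝ) / (4 * √(Real.pi / 2)))
  rw [mul_zero] at h
  refine h.congr' ?_
  filter_upwards [eventually_gt_atTop 0] with X hX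
  have hc : (0 : ℝ) < √(Real.pi / 2) := Real.sqrt_pos.mpr (by have := Real.pi_pos; positivity)
  have e1 : Real.exp (-(√18 - 2 * √3) * X) =
      Real.exp (-(√18 * (X - 1))) * (Real.exp √18)⁻¹ * (Real.exp (-(2 * √3 * X)))⁻¹ := by
    rw [← Real.exp_neg, ← Real.exp_neg, ← Real.exp_add, ← Real.exp_add]
    ring_nf
  rw [leadingTerm, e1, Real.mul_rpow (by positivity) hX.le]
  have : 0 < X ^ (3 / 2 : ℝ) := by positivity
  have : (0 : ℝ) < (2 * √3) ^ (3 / 2 : ℝ) := by positivity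
  field_simp

lemma tendsto_tsum_seriesTerm_div_leadingTerm :
    Tendsto (fun X => (∑' n, seriesTerm 1 X n) / leadingTerm X) atTop (𝓝 1) := by
  set T := ∑' n, seriesTerm 1 1 (n + 1) with hT
  have hsum1 : Summable fun n => seriesTerm 1 1 (n + 1) :=
    (summable_nat_add_iff 1).mpr (summable_seriesTerm one_pos one_pos)
  have htail : ∀ X : ℝ, 1 ≤ X → ∑' n, seriesTerm 1 X (n + 1) ≤
      Real.exp (-(√18 * (X - 1))) * T := by
    intro X hX
    rw [hT, ← tsum_mul_left]
    refine Summable.tsum_le_tsum (fun n => ?_)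
      ((summable_nat_add_iff 1).mpr (summable_seriesTerm one_pos (by linarith)))
      (hsum1.mul_left _)
    refine seriesTerm_le one_pos hX (Real.sqrt_le_sqrt ?_)
    push_cast
    linarith [n.cast_nonneg (α := ℝ)]
  have h0 : Tendsto (fun X => (∑' n, seriesTerm 1 X (n + 1)) / leadingTerm X) atTop (𝓝 0) := by
    refine squeeze_zero' ?_ ?_ (tendsto_tail_div_leadingTerm T)
    · filter_upwards [eventually_gt_atTop 0] with X hX
      exact div_nonneg (tsum_nonneg fun n => seriesTerm_nonneg one_pos hX _)
        (leadingTerm_pos hX).le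
    · filter_upwards [eventually_ge_atTop 1] with X hX
      exact div_le_div_of_nonneg_right (htail X hX) (leadingTerm_pos (by linarith)).le
  have h := tendsto_seriesTerm_zero_div_leadingTerm.add h0
  rw [add_zero] at h
  refine h.congr' ?_
  filter_upwards [eventually_gt_atTop 0] with X hX
  rw [(summable_seriesTerm one_pos hX).tsum_eq_zero_add, add_div]

lemma positionSpace_asymptotics {ε : ℝ} (hε : 0 < ε) : ∃ R : ℝ, 0 < R ∧ ∀ Λ x : ℝ, 0 < Λ →
    R ≤ Λ * x → |positionSpace Λ x - largeDistance Λ x| ≤ ε * |largeDistance Λ x| := by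
  obtain ⟨R, hR⟩ := eventually_atTop.mp
    (tendsto_tsum_seriesTerm_div_leadingTerm.eventually (Metric.closedBall_mem_nhds 1 hε))
  refine ⟨max R 1, by positivity, fun Λ x _ hx => ?_⟩
  have hX : 0 < Λ * x := lt_of_lt_of_le (by positivity) hx
  have h := hR (Λ * x) ((le_max_left _ _).trans hx)
  rw [Real.dist_eq] at h
  have hl := leadingTerm_pos hX
  have e1 : positionSpace Λ x =
      -(Real.pi ^ 2 / 2) * (6 * Λ ^ 2) ^ 4 * ∑' n, seriesTerm 1 (Λ * x) n := by
    simp only [positionSpace, funext (seriesTerm_eq Λ x)]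
  have e2 : largeDistance Λ x =
      -(Real.pi ^ 2 / 2) * (6 * Λ ^ 2) ^ 4 * leadingTerm (Λ * x) := by
    simp only [largeDistance, leadingTerm, mul_assoc]
    ring
  rw [e1, e2, ← mul_sub]
  generalize -(Real.pi ^ 2 / 2) * (6 * Λ ^ 2) ^ 4 = c
  rw [abs_mul, abs_mul, mul_left_comm]
  refine mul_le_mul_of_nonneg_left ?_ (abs_nonneg _)
  rw [abs_of_pos hl, ← div_le_iff₀ hl, ← abs_of_pos hl, ← abs_div, abs_of_pos hl, sub_div,
    div_self hl.ne']
  exact h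

/-! ### Fourier transforms against functions vanishing near the origin. -/

open scoped SchwartzMap FourierTransform Laplacian

lemma neg_inv_two_pi_ne_zero : -(2 * Real.pi)⁻¹ ≠ 0 :=
  neg_ne_zero.mpr (inv_ne_zero (by positivity))

/-- The Fourier transform `p ↦ ∫ e^{i p·x} F(x) dx` on Schwartz functions. -/
def angularFourier (F : 𝓢(R4, ℂ)) : 𝓢(R4, ℂ) :=
  SchwartzMap.compCLMOfContinuousLinearEquiv ℂ
    (ContinuousLinearEquiv.smulLeft (R₁ := ℝ) (M₁ := R4)
      (Units.mk0 (-(2 * Real.pi)⁻¹) neg_inv_two_pi_ne_zero)) (𝓕 F)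

lemma angularFourier_eq_fourier (F : 𝓢(R4, ℂ)) (p : R4) :
    angularFourier F p = 𝓕 F (-(2 * Real.pi)⁻¹ • p) := rfl

/-- Evaluating `𝓕`, whose kernel is `e^{-2πi x·ξ}`, at `ξ = -p/(2π)` produces `e^{ip·x}` with no
Jacobian. -/
lemma angularFourier_apply (F : 𝓢(R4, ℂ)) (p : R4) :
    angularFourier F p = ∫ x : R4, Complex.exp (Complex.I * ((inner ℝ p x : ℝ) : ℂ)) * F x := by
  rw [angularFourier_eq_fourier, SchwartzMap.fourier_coe, Real.fourier_eq']
  refine integral_congr_ae (Eventually.of_forall fun x => ?_)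
  simp only [smul_eq_mul]
  congr 2
  rw [inner_smul_right, real_inner_comm, mul_comm Complex.I]
  congr 2
  have := Real.pi_pos
  field_simp

lemma integrable_eval_mul (G : 𝓢(R4, ℂ)) (P : Polynomial ℝ) :
    Integrable fun p : R4 => ((P.eval (‖p‖ ^ 2) : ℝ) : ℂ) * G p := by
  induction P using Polynomial.induction_on' with
  | add P Q hP hQ =>
    refine (hP.add hQ).congr (Eventually.of_forall fun p => ?_)
    simp only [Polynomial.eval_add, Complex.ofReal_add, Pi.add_apply]
    ring
  | monomial n a =>
    have h := (G.integrable_pow_mul volume (2 * n)).const_mul |a|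
    refine h.mono (Continuous.aestronglyMeasurable (by fun_prop))
      (Eventually.of_forall fun p => le_of_eq ?_)
    simp only [Polynomial.eval_monomial, norm_mul, Complex.norm_real, Real.norm_eq_abs, abs_abs,
      abs_pow, abs_norm]
    ring

lemma integrable_eval_norm_mul (G : 𝓢(R4, ℂ)) (P : Polynomial ℝ) :
    Integrable fun p : R4 => P.eval (‖p‖ ^ 2) * ‖G p‖ := by
  refine ((integrable_eval_mul G P).norm).mono (Continuous.aestronglyMeasurable (by fun_prop))
    (Eventually.of_forall fun p => ?_)
  simp

lemma fourier_laplacian_apply (F : 𝓢(R4, ℂ)) (ξ : R4) :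
    𝓕 (Δ F) ξ = -(2 * (Real.pi : ℂ)) ^ 2 * ((‖ξ‖ : ℂ) ^ 2 * 𝓕 F ξ) := by
  have hg : (fun x : R4 => ‖x‖ ^ 2).HasTemperateGrowth := by fun_prop
  rw [SchwartzMap.laplacian_eq_fourierMultiplierCLM, SchwartzMap.fourierMultiplierCLM_apply,
    FourierTransform.fourier_smul, FourierTransform.fourier_fourierInv_eq]
  rw [smul_apply]
  erw [SchwartzMap.smulLeftCLM_apply_apply hg]
  simp only [Complex.real_smul]
  push_cast
  ring

/-- Fourier inversion at `0` expresses the integral as a multiple of `(Δ^k F)(0)`; the induction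
works because `Δ F` again vanishes near `0`. -/
lemma integral_norm_pow_mul_fourier (k : ℕ) : ∀ F : 𝓢(R4, ℂ), (F : R4 → ℂ) =ᶠ[𝓝 0] 0 →
    ∫ ξ : R4, ((‖ξ‖ : ℂ) ^ 2) ^ k * 𝓕 F ξ = 0 := by
  induction k with
  | zero =>
    intro F hF
    have h : (𝓕⁻ (𝓕 F)) 0 = F 0 := by rw [FourierTransform.fourierInv_fourier_eq]
    rw [SchwartzMap.fourierInv_coe, Real.fourierInv_eq'] at h
    simpa [hF.eq_of_nhds] using h
  | succ k ih =>
    intro F hF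
    have hΔ : ((Δ F : 𝓢(R4, ℂ)) : R4 → ℂ) =ᶠ[𝓝 0] 0 := by
      filter_upwards [InnerProductSpace.laplacian_congr_nhds hF] with x hx
      rw [SchwartzMap.laplacian_apply, hx]
      simp [InnerProductSpace.laplacian_eq_iteratedFDeriv_stdOrthonormalBasis]
    have h := ih (Δ F) hΔ
    simp only [fourier_laplacian_apply] at h
    have hpi : -(2 * (Real.pi : ℂ)) ^ 2 ≠ 0 := by simp [Real.pi_ne_zero]
    have e : ∀ ξ : R4, ((‖ξ‖ : ℂ) ^ 2) ^ k * (-(2 * (Real.pi : ℂ)) ^ 2 * ((‖ξ‖ : ℂ) ^ 2 * 𝓕 F ξ)) =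
        -(2 * (Real.pi : ℂ)) ^ 2 * (((‖ξ‖ : ℂ) ^ 2) ^ (k + 1) * 𝓕 F ξ) := fun ξ => by ring
    simp only [e, integral_const_mul] at h
    exact (mul_eq_zero.mp h).resolve_left hpi

/-- Polynomials in `p²` are contact terms. -/
lemma integral_eval_mul_angularFourier {F : 𝓢(R4, ℂ)} (hF : (F : R4 → ℂ) =ᶠ[𝓝 0] 0)
    (P : Polynomial ℝ) :
    ∫ p : R4, ((P.eval (‖p‖ ^ 2) : ℝ) : ℂ) * angularFourier F p = 0 := by
  induction P using Polynomial.induction_on' with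
  | add P Q hP hQ =>
    simp only [Polynomial.eval_add, Complex.ofReal_add, add_mul]
    rw [integral_add (integrable_eval_mul _ P) (integrable_eval_mul _ Q), hP, hQ, add_zero]
  | monomial n a =>
    have h := Measure.integral_comp_smul (volume : Measure R4)
      (fun ξ : R4 => ((‖ξ‖ : ℂ) ^ 2) ^ n * 𝓕 F ξ) (-(2 * Real.pi)⁻¹)
    rw [integral_norm_pow_mul_fourier n F hF, smul_zero] at h
    have e : ∀ p : R4, ((Polynomial.eval (‖p‖ ^ 2) (Polynomial.monomial n a) : ℝ) : ℂ) *
        angularFourier F p = (a : ℂ) * ((2 * Real.pi) ^ 2) ^ n *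
          (((‖-(2 * Real.pi)⁻¹ • p‖ : ℂ) ^ 2) ^ n * 𝓕 F (-(2 * Real.pi)⁻¹ • p)) := by
      intro p
      have hpi : (Real.pi : ℂ) ≠ 0 := Complex.ofReal_ne_zero.mpr Real.pi_ne_zero
      rw [angularFourier_eq_fourier, norm_smul, norm_neg, norm_inv, Real.norm_eq_abs,
        abs_of_pos (by positivity : 0 < 2 * Real.pi), Polynomial.eval_monomial]
      push_cast
      have e2 : ((2 * (Real.pi : ℂ)) ^ 2) ^ n * (((2 * (Real.pi : ℂ))⁻¹ * ‖p‖) ^ 2) ^ n =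
          ((‖p‖ : ℂ) ^ 2) ^ n := by
        rw [← mul_pow, ← mul_pow, mul_inv_cancel_left₀ (mul_ne_zero two_ne_zero hpi)]
      rw [← e2]
      ring
    simp only [e, integral_const_mul, h, mul_zero]

/-- Dominated convergence for series with a product bound. -/
lemma integrable_and_hasSum_integral {α : Type*} [MeasurableSpace α] {ν : Measure α}
    {F : ℕ → α → ℂ} {S : α → ℂ} {b : α → ℝ} {c : ℕ → ℝ}
    (hF : ∀ n, AEStronglyMeasurable (F n) ν) (hS : ∀ a, HasSum (fun n => F n a) (S a))
    (hb : ∀ n a, ‖F n a‖ ≤ c n * b a) (hbi : Integrable b ν) (hc : Summable c) :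
    Integrable S ν ∧ HasSum (fun n => ∫ a, F n a ∂ν) (∫ a, S a ∂ν) := by
  constructor
  · refine Integrable.mono' (hbi.const_mul (∑' n, c n)) ?_ (Eventually.of_forall fun a => ?_)
    · exact aestronglyMeasurable_of_tendsto_ae atTop
        (f := fun (N : ℕ) a => ∑ n ∈ Finset.range N, F n a)
        (fun N => Finset.aestronglyMeasurable_fun_sum _ fun n _ => hF n)
        (Eventually.of_forall fun a => (hS a).tendsto_sum_nat)
    · rw [← (hS a).tsum_eq, ← tsum_mul_right]
      exact tsum_of_norm_bounded (hc.mul_right (b a)).hasSum fun n => hb n a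
  · refine hasSum_integral_of_dominated_convergence (fun n a => c n * b a) hF
      (fun n => Eventually.of_forall fun a => hb n a)
      (Eventually.of_forall fun a => hc.mul_right (b a)) ?_ (Eventually.of_forall hS)
    simp only [tsum_mul_right]
    exact hbi.const_mul _

lemma measurable_besselK_one : Measurable (besselK 1) := by
  refine StronglyMeasurable.measurable (StronglyMeasurable.integral_prod_right
    (f := fun x t : ℝ => Real.exp (-(x * Real.cosh t)) * Real.cosh (1 * t)) ?_)
  exact Continuous.stronglyMeasurable (by fun_prop)

lemma integrable_gaussian {τ : ℝ} (hτ : 0 < τ) :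
    Integrable fun p : R4 => Complex.exp (-(τ * ‖p‖ ^ 2 : ℝ)) := by
  have h := GaussianFourier.integrable_cexp_neg_mul_sq_norm_add (V := R4) (b := (τ : ℂ))
    (by simpa using hτ) 0 0
  refine h.congr (Eventually.of_forall fun p => ?_)
  simp

/-- The Gaussian is self-dual under the Fourier transform. -/
lemma integral_gaussian_mul_angularFourier (F : 𝓢(R4, ℂ)) {τ : ℝ} (hτ : 0 < τ) :
    ∫ p : R4, Complex.exp (-(τ * ‖p‖ ^ 2 : ℝ)) * angularFourier F p =
      ∫ x : R4, (((Real.pi / τ) ^ 2 * Real.exp (-(‖x‖ ^ 2 / (4 * τ))) : ℝ) : ℂ) * F x := by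
  have hint : Integrable (Function.uncurry fun (p x : R4) => Complex.exp (-(τ * ‖p‖ ^ 2 : ℝ)) *
      (Complex.exp (Complex.I * ((inner ℝ p x : ℝ) : ℂ)) * F x)) (volume.prod volume) := by
    refine ((integrable_gaussian hτ).mul_prod F.integrable).mono
      (Continuous.aestronglyMeasurable ?_) (Eventually.of_forall fun q => ?_)
    · have := F.continuous
      simp only [Function.uncurry_def]
      fun_prop
    · simp only [Function.uncurry_def, norm_mul]
      rw [mul_comm Complex.I, Complex.norm_exp_ofReal_mul_I, one_mul]
  have h1 : ∀ p : R4, Complex.exp (-(τ * ‖p‖ ^ 2 : ℝ)) * angularFourier F p =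
      ∫ x : R4, Complex.exp (-(τ * ‖p‖ ^ 2 : ℝ)) *
        (Complex.exp (Complex.I * ((inner ℝ p x : ℝ) : ℂ)) * F x) := fun p => by
    rw [integral_const_mul, angularFourier_apply]
  simp only [h1]
  rw [integral_integral_swap hint]
  refine integral_congr_ae (Eventually.of_forall fun x => ?_)
  have h2 : ∀ p : R4, Complex.exp (-(τ * ‖p‖ ^ 2 : ℝ)) *
      (Complex.exp (Complex.I * ((inner ℝ p x : ℝ) : ℂ)) * F x) =
      Complex.exp (-(τ : ℂ) * ‖p‖ ^ 2 + Complex.I * ((inner ℝ x p : ℝ) : ℂ)) * F x := fun p => by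
    rw [Complex.exp_add, real_inner_comm, ← mul_assoc]
    push_cast
    ring_nf
  simp only [h2]
  rw [integral_mul_const, GaussianFourier.integral_cexp_neg_mul_sq_norm_add (by simpa using hτ)]
  congr 1
  have hd : ((Module.finrank ℝ R4 : ℂ) / 2) = ((2 : ℕ) : ℂ) := by
    simp only [finrank_euclideanSpace, Fintype.card_fin]; norm_num
  rw [hd, Complex.cpow_natCast, Complex.I_sq]
  push_cast
  congr 2
  ring

lemma integral_exp_neg_mul_Ioi {c : ℝ} (hc : 0 < c) :
    ∫ τ in Ioi (0 : ℝ), Real.exp (-(c * τ)) = 1 / c := by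
  have h := laplace_one hc
  simpa [laplace] using h

/-- The position space Green function of `p² + m²`. -/
def yukawa (m r : ℝ) : ℝ := 4 * Real.pi ^ 2 * m ^ 2 * (besselK 1 (m * r) / (m * r))

lemma yukawa_nonneg {m r : ℝ} (hm : 0 < m) (hr : 0 ≤ r) : 0 ≤ yukawa m r := by
  have := besselK_one_nonneg (m * r)
  unfold yukawa
  positivity

lemma yukawa_anti {m r r' : ℝ} (hm : 0 < m) (hr : 0 < r) (h : r ≤ r') :
    yukawa m r' ≤ yukawa m r := by
  have hmr : m * r ≤ m * r' := mul_le_mul_of_nonneg_left h hm.le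
  have hmr0 : 0 < m * r := mul_pos hm hr
  refine mul_le_mul_of_nonneg_left (div_le_div₀ (besselK_one_nonneg _) ?_ hmr0 hmr) (by positivity)
  refine (besselK_one_le hmr0 hmr).trans (mul_le_of_le_one_left (besselK_one_nonneg _) ?_)
  exact Real.exp_le_one_iff.mpr (by linarith)

lemma measurable_yukawa (m : ℝ) : Measurable (yukawa m) :=
  ((measurable_besselK_one.comp (measurable_const_mul m)).div (measurable_const_mul m)).const_mul _

lemma exists_pos_forall_norm_lt {F : R4 → ℂ} (hF : F =ᶠ[𝓝 0] 0) :
    ∃ r : ℝ, 0 < r ∧ ∀ x : R4, ‖x‖ < r → F x = 0 := by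
  obtain ⟨r, hr, h⟩ := Metric.eventually_nhds_iff.mp hF
  exact ⟨r, hr, fun x hx => h (by simpa using hx)⟩

/-- A radially decreasing kernel is integrable against a function vanishing near the origin. -/
lemma norm_kernel_mul_le {k : ℝ → ℝ} {F : R4 → ℂ} {r : ℝ} (hr : 0 < r)
    (hF : ∀ x : R4, ‖x‖ < r → F x = 0) (hk0 : ∀ y, 0 < y → 0 ≤ k y)
    (hk : ∀ y, r ≤ y → k y ≤ k r) (x : R4) : ‖((k ‖x‖ : ℝ) : ℂ) * F x‖ ≤ k r * ‖F x‖ := by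
  rw [norm_mul, Complex.norm_real, Real.norm_eq_abs]
  rcases lt_or_ge ‖x‖ r with h | h
  · simp [hF x h]
  · rw [abs_of_nonneg (hk0 _ (hr.trans_le h))]
    exact mul_le_mul_of_nonneg_right (hk _ h) (norm_nonneg _)

lemma integrable_yukawa_mul {F : 𝓢(R4, ℂ)} (hF : (F : R4 → ℂ) =ᶠ[𝓝 0] 0) {m : ℝ} (hm : 0 < m) :
    Integrable fun x : R4 => ((yukawa m ‖x‖ : ℝ) : ℂ) * F x := by
  obtain ⟨r, hr, h⟩ := exists_pos_forall_norm_lt hF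
  refine Integrable.mono' (F.integrable.norm.const_mul (yukawa m r)) ?_
    (Eventually.of_forall fun x => norm_kernel_mul_le hr h
      (fun y hy => yukawa_nonneg hm hy.le) (fun y hy => yukawa_anti hm hr hy) x)
  exact ((Complex.measurable_ofReal.comp ((measurable_yukawa m).comp
    measurable_norm)).aestronglyMeasurable).mul F.continuous.aestronglyMeasurable

/-- The Fourier transform of the propagator `1 / (p² + m²)`, away from the origin. -/
lemma integral_propagator_mul_angularFourier {F : 𝓢(R4, ℂ)} (hF : (F : R4 → ℂ) =ᶠ[𝓝 0] 0) {m : ℝ}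
    (hm : 0 < m) :
    ∫ p : R4, ((1 / (‖p‖ ^ 2 + m ^ 2) : ℝ) : ℂ) * angularFourier F p =
      ∫ x : R4, ((yukawa m ‖x‖ : ℝ) : ℂ) * F x := by
  set G := angularFourier F with hG
  have hpos : ∀ p : R4, 0 < ‖p‖ ^ 2 + m ^ 2 := fun p => by positivity
  have hF0 : F 0 = 0 := hF.eq_of_nhds
  have hi1 : Integrable (Function.uncurry fun (p : R4) (τ : ℝ) =>
      ((Real.exp (-((‖p‖ ^ 2 + m ^ 2) * τ)) : ℝ) : ℂ) * G p)
      (volume.prod (volume.restrict (Ioi 0))) := by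
    have hm1 : AEStronglyMeasurable (Function.uncurry fun (p : R4) (τ : ℝ) =>
        ((Real.exp (-((‖p‖ ^ 2 + m ^ 2) * τ)) : ℝ) : ℂ) * G p)
        (volume.prod (volume.restrict (Ioi 0))) := by
      refine Continuous.aestronglyMeasurable ?_
      have := G.continuous
      simp only [Function.uncurry_def]
      fun_prop
    rw [integrable_prod_iff hm1]
    simp only [Function.uncurry_apply_pair]
    constructor
    · exact Eventually.of_forall fun p =>
        ((integrableOn_exp_neg_mul (hpos p)).ofReal (𝕜 := ℂ)).mul_const _
    · have e : ∀ p : R4, ∫ τ in Ioi (0 : ℝ), ‖((Real.exp (-((‖p‖ ^ 2 + m ^ 2) * τ)) : ℝ) : ℂ) * G p‖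
          = 1 / (‖p‖ ^ 2 + m ^ 2) * ‖G p‖ := fun p => by
        simp only [norm_mul, Complex.norm_real, Real.norm_eq_abs, Real.abs_exp]
        rw [integral_mul_const, integral_exp_neg_mul_Ioi (hpos p)]
      simp only [e]
      refine Integrable.mono' (G.integrable.norm.const_mul (1 / m ^ 2)) ?_
        (Eventually.of_forall fun p => ?_)
      · refine Continuous.aestronglyMeasurable (Continuous.mul ?_ (by fun_prop))
        exact continuous_const.div (by fun_prop) fun p => (hpos p).ne'
      · rw [Real.norm_eq_abs, abs_of_nonneg (by positivity)]
        refine mul_le_mul_of_nonneg_right (one_div_le_one_div_of_le (by positivity) ?_)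
          (norm_nonneg _)
        linarith [sq_nonneg ‖p‖]
  have hk : ∀ (x : R4) (τ : ℝ), τ ∈ Ioi (0 : ℝ) → (Complex.exp (-(m ^ 2 * τ : ℝ)) *
      ((((Real.pi / τ) ^ 2 * Real.exp (-(‖x‖ ^ 2 / (4 * τ))) : ℝ) : ℂ) * F x)) =
      ((Real.exp (-(m ^ 2 * τ)) * ((Real.pi / τ) ^ 2 * Real.exp (-(‖x‖ ^ 2 / (4 * τ)))) : ℝ) : ℂ) *
        F x := fun x τ _ => by
    push_cast
    ring
  -- The `τ`-integral of the heat kernel is `yukawa m ‖x‖`, so absolute integrability reduces to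
  -- `integrable_yukawa_mul`, where the vanishing of `F` near `0` is essential.
  have hi2 : Integrable (Function.uncurry fun (x : R4) (τ : ℝ) =>
      ((Real.exp (-(m ^ 2 * τ)) * ((Real.pi / τ) ^ 2 * Real.exp (-(‖x‖ ^ 2 / (4 * τ)))) : ℝ) : ℂ) *
        F x) (volume.prod (volume.restrict (Ioi 0))) := by
    have hm2 : AEStronglyMeasurable (Function.uncurry fun (x : R4) (τ : ℝ) =>
        ((Real.exp (-(m ^ 2 * τ)) * ((Real.pi / τ) ^ 2 * Real.exp (-(‖x‖ ^ 2 / (4 * τ)))) : ℝ) : ℂ)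
          * F x) (volume.prod (volume.restrict (Ioi 0))) := by
      refine Measurable.aestronglyMeasurable ?_
      have := F.continuous.measurable
      simp only [Function.uncurry_def]
      fun_prop
    rw [integrable_prod_iff hm2]
    simp only [Function.uncurry_apply_pair]
    constructor
    · refine Eventually.of_forall fun x => ?_
      rcases eq_or_ne x 0 with rfl | hx
      · simp [hF0]
      · exact ((integral_heat_kernel hm (norm_pos_iff.mpr hx)).1.ofReal (𝕜 := ℂ)).mul_const _
    · have e : ∀ x : R4, ∫ τ in Ioi (0 : ℝ), ‖((Real.exp (-(m ^ 2 * τ)) *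
          ((Real.pi / τ) ^ 2 * Real.exp (-(‖x‖ ^ 2 / (4 * τ)))) : ℝ) : ℂ) * F x‖ =
          ‖((yukawa m ‖x‖ : ℝ) : ℂ) * F x‖ := by
        intro x
        rcases eq_or_ne x 0 with rfl | hx
        · simp [hF0]
        · have hx0 := norm_pos_iff.mpr hx
          rw [norm_mul, Complex.norm_real, Real.norm_eq_abs,
            abs_of_nonneg (yukawa_nonneg hm hx0.le), yukawa, ← (integral_heat_kernel hm hx0).2,
            ← integral_mul_const]
          refine integral_congr_ae (Eventually.of_forall fun τ => ?_)
          simp only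
          rw [norm_mul, Complex.norm_real, Real.norm_eq_abs, abs_of_nonneg (by positivity)]
      simp only [e]
      exact (integrable_yukawa_mul hF hm).norm
  -- Write the propagator as `∫ e^{-(p² + m²)τ} dτ`, transform the Gaussian at each fixed `τ`, and
  -- integrate over `τ` again on the position side.
  calc ∫ p : R4, ((1 / (‖p‖ ^ 2 + m ^ 2) : ℝ) : ℂ) * G p
      = ∫ p : R4, ∫ τ in Ioi (0 : ℝ), ((Real.exp (-((‖p‖ ^ 2 + m ^ 2) * τ)) : ℝ) : ℂ) * G p := by
        refine integral_congr_ae (Eventually.of_forall fun p => ?_)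
        simp only
        rw [integral_mul_const, integral_complex_ofReal, integral_exp_neg_mul_Ioi (hpos p)]
    _ = ∫ τ in Ioi (0 : ℝ), ∫ p : R4, ((Real.exp (-((‖p‖ ^ 2 + m ^ 2) * τ)) : ℝ) : ℂ) * G p :=
        integral_integral_swap hi1
    _ = ∫ τ in Ioi (0 : ℝ), ∫ x : R4, ((Real.exp (-(m ^ 2 * τ)) *
          ((Real.pi / τ) ^ 2 * Real.exp (-(‖x‖ ^ 2 / (4 * τ)))) : ℝ) : ℂ) * F x := by
        refine setIntegral_congr_fun measurableSet_Ioi fun τ hτ => ?_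
        have h1 : ∀ p : R4, ((Real.exp (-((‖p‖ ^ 2 + m ^ 2) * τ)) : ℝ) : ℂ) * G p =
            Complex.exp (-(m ^ 2 * τ : ℝ)) * (Complex.exp (-(τ * ‖p‖ ^ 2 : ℝ)) * G p) := by
          intro p
          rw [← mul_assoc, ← Complex.exp_add, Complex.ofReal_exp]
          push_cast
          ring_nf
        simp only [h1]
        rw [integral_const_mul, hG, integral_gaussian_mul_angularFourier F hτ,
          ← integral_const_mul]
        exact integral_congr_ae (Eventually.of_forall fun x => hk x τ hτ)
    _ = ∫ x : R4, ∫ τ in Ioi (0 : ℝ), ((Real.exp (-(m ^ 2 * τ)) *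
          ((Real.pi / τ) ^ 2 * Real.exp (-(‖x‖ ^ 2 / (4 * τ)))) : ℝ) : ℂ) * F x :=
        (integral_integral_swap hi2).symm
    _ = _ := by
        refine integral_congr_ae (Eventually.of_forall fun x => ?_)
        simp only
        rcases eq_or_ne x 0 with rfl | hx
        · simp [hF0]
        · rw [integral_mul_const, integral_complex_ofReal,
            (integral_heat_kernel hm (norm_pos_iff.mpr hx)).2, yukawa]

/-! ### The spectral sum and its Fourier transform. -/

/-- The mass of the `n`-th glueball state. -/
def glueballMass (Λ : ℝ) (n : ℕ) : ℝ := √(6 * ((n : ℝ) + 2)) * Λ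

lemma glueballMass_pos {Λ : ℝ} (hΛ : 0 < Λ) (n : ℕ) : 0 < glueballMass Λ n :=
  mul_pos (Real.sqrt_pos.mpr (by positivity)) hΛ

lemma glueballMass_sq (Λ : ℝ) (n : ℕ) : glueballMass Λ n ^ 2 = 6 * Λ ^ 2 * ((n : ℝ) + 2) := by
  rw [glueballMass, mul_pow, Real.sq_sqrt (by positivity)]
  ring

lemma seriesTerm_eq_yukawa {Λ : ℝ} (hΛ : 0 < Λ) (n : ℕ) (r : ℝ) :
    seriesTerm Λ r n = ((n : ℝ) + 1) * ((n : ℝ) + 2) / (4 * Real.pi ^ 2 * (6 * Λ ^ 2)) *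
      yukawa (glueballMass Λ n) r := by
  have := Real.pi_pos
  rw [yukawa, glueballMass_sq, seriesTerm, glueballMass]
  field_simp

open Polynomial in
/-- The local part of the `n`-th term of the spectral sum. -/
def spectralContact (Λ : ℝ) (n : ℕ) : ℝ[X] :=
  C (1 / ((n : ℝ) + 1)) * (X * (X + C (6 * Λ ^ 2))) -
    C (6 * Λ ^ 2) * (X + C (6 * Λ ^ 2 - glueballMass Λ n ^ 2))

/-- Polynomial division by `s + m_n²`: at the pole `s = -m_n²` the prefactor `s(s + 6Λ²)` equals
`(6Λ²)²(n + 1)(n + 2)`. -/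
lemma spectral_decomposition {Λ s : ℝ} (hΛ : 0 < Λ) (hs : 0 ≤ s) (n : ℕ) :
    s * (s + 6 * Λ ^ 2) * (1 / ((n : ℝ) + 1) - 1 / ((n : ℝ) + s / (6 * Λ ^ 2) + 2)) =
      (spectralContact Λ n).eval s - (6 * Λ ^ 2) ^ 3 * (((n : ℝ) + 1) * ((n : ℝ) + 2)) *
        (1 / (s + glueballMass Λ n ^ 2)) := by
  have h1 : (n : ℝ) + s / (6 * Λ ^ 2) + 2 = (s + glueballMass Λ n ^ 2) / (6 * Λ ^ 2) := by
    rw [glueballMass_sq]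
    field_simp
    ring
  have h2 : 0 < s + glueballMass Λ n ^ 2 := by
    have := glueballMass_pos hΛ n
    positivity
  rw [h1, one_div_div]
  simp only [spectralContact, Polynomial.eval_sub, Polynomial.eval_mul, Polynomial.eval_C,
    Polynomial.eval_X, Polynomial.eval_add]
  rw [glueballMass_sq] at h2 ⊢
  field_simp
  ring

lemma integral_spectral_term {F : 𝓢(R4, ℂ)} (hF : (F : R4 → ℂ) =ᶠ[𝓝 0] 0) {Λ : ℝ} (hΛ : 0 < Λ)
    (n : ℕ) :
    ∫ p : R4, ((‖p‖ ^ 2 * (‖p‖ ^ 2 + 6 * Λ ^ 2) *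
      (1 / ((n : ℝ) + 1) - 1 / ((n : ℝ) + ‖p‖ ^ 2 / (6 * Λ ^ 2) + 2)) : ℝ) : ℂ) *
        angularFourier F p =
      ((-(4 * Real.pi ^ 2 * (6 * Λ ^ 2) ^ 4) : ℝ) : ℂ) *
        ∫ x : R4, ((seriesTerm Λ ‖x‖ n : ℝ) : ℂ) * F x := by
  have hm := glueballMass_pos hΛ n
  set G := angularFourier F with hG
  set A : ℝ := (6 * Λ ^ 2) ^ 3 * (((n : ℝ) + 1) * ((n : ℝ) + 2)) with hA
  have hi : Integrable fun p : R4 => ((1 / (‖p‖ ^ 2 + glueballMass Λ n ^ 2) : ℝ) : ℂ) * G p := by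
    refine (G.integrable.norm.const_mul (1 / glueballMass Λ n ^ 2)).mono' ?_
      (Eventually.of_forall fun p => ?_)
    · refine Continuous.aestronglyMeasurable (Continuous.mul (Complex.continuous_ofReal.comp ?_)
        G.continuous)
      exact continuous_const.div (by fun_prop) fun p => by positivity
    · rw [norm_mul, Complex.norm_real, Real.norm_eq_abs, abs_of_nonneg (by positivity)]
      refine mul_le_mul_of_nonneg_right (one_div_le_one_div_of_le (by positivity) ?_)
        (norm_nonneg _)
      linarith [sq_nonneg ‖p‖]
  have e1 : ∀ p : R4, ((‖p‖ ^ 2 * (‖p‖ ^ 2 + 6 * Λ ^ 2) *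
      (1 / ((n : ℝ) + 1) - 1 / ((n : ℝ) + ‖p‖ ^ 2 / (6 * Λ ^ 2) + 2)) : ℝ) : ℂ) * G p =
      (((spectralContact Λ n).eval (‖p‖ ^ 2) : ℝ) : ℂ) * G p -
        (A : ℂ) * (((1 / (‖p‖ ^ 2 + glueballMass Λ n ^ 2) : ℝ) : ℂ) * G p) := by
    intro p
    rw [spectral_decomposition hΛ (sq_nonneg _) n, ← hA, Complex.ofReal_sub, Complex.ofReal_mul]
    ring
  simp only [e1]
  rw [integral_sub (integrable_eval_mul G _) (hi.const_mul _), hG,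
    integral_eval_mul_angularFourier hF, integral_const_mul,
    integral_propagator_mul_angularFourier hF hm, zero_sub, ← integral_const_mul,
    ← integral_const_mul, ← integral_neg]
  refine integral_congr_ae (Eventually.of_forall fun x => ?_)
  simp only
  have hreal : -(A * yukawa (glueballMass Λ n) ‖x‖) =
      -(4 * Real.pi ^ 2 * (6 * Λ ^ 2) ^ 4) * seriesTerm Λ ‖x‖ n := by
    have := Real.pi_pos
    rw [seriesTerm_eq_yukawa hΛ, hA]
    field_simp
  have hcomplex := congrArg Complex.ofReal hreal
  push_cast at hcomplex ⊢
  linear_combination F x * hcomplex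

/-- The nonlocal part of the renormalized response function. -/
def nonlocalResponse (Λ s : ℝ) : ℝ :=
  1 / 8 * (s * (s + 6 * Λ ^ 2) * harmonicShift (s / (6 * Λ ^ 2)))

lemma measurable_seriesTerm (Λ : ℝ) (n : ℕ) : Measurable fun x => seriesTerm Λ x n :=
  ((measurable_besselK_one.comp (measurable_const_mul _)).div
    (measurable_const_mul _)).const_mul _

lemma nonlocalResponse_mul_angularFourier {F : 𝓢(R4, ℂ)} (hF : (F : R4 → ℂ) =ᶠ[𝓝 0] 0)
    {Λ : ℝ} (hΛ : 0 < Λ) :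
    Integrable (fun p : R4 => ((nonlocalResponse Λ (‖p‖ ^ 2) : ℝ) : ℂ) * angularFourier F p) ∧
    Integrable (fun x : R4 => ((positionSpace Λ ‖x‖ : ℝ) : ℂ) * F x) ∧
    ∫ p : R4, ((nonlocalResponse Λ (‖p‖ ^ 2) : ℝ) : ℂ) * angularFourier F p =
      ∫ x : R4, ((positionSpace Λ ‖x‖ : ℝ) : ℂ) * F x := by
  set G := angularFourier F with hG
  have ha : ∀ p : R4, 0 ≤ ‖p‖ ^ 2 / (6 * Λ ^ 2) := fun p => by positivity
  -- The terms are dominated by `1/(n + 1)²` times a polynomial in `p²`, which the Schwartz decay of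
  -- `G` makes integrable.
  obtain ⟨hmi, hms⟩ := integrable_and_hasSum_integral (ν := (volume : Measure R4))
    (F := fun n p => ((‖p‖ ^ 2 * (‖p‖ ^ 2 + 6 * Λ ^ 2) *
      (1 / ((n : ℝ) + 1) - 1 / ((n : ℝ) + ‖p‖ ^ 2 / (6 * Λ ^ 2) + 2)) : ℝ) : ℂ) * G p)
    (S := fun p => ((‖p‖ ^ 2 * (‖p‖ ^ 2 + 6 * Λ ^ 2) *
      harmonicShift (‖p‖ ^ 2 / (6 * Λ ^ 2)) : ℝ) : ℂ) * G p)
    (b := fun p => (Polynomial.X * (Polynomial.X + Polynomial.C (6 * Λ ^ 2)) *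
      (Polynomial.C (1 / (6 * Λ ^ 2)) * Polynomial.X + 1) : Polynomial ℝ).eval (‖p‖ ^ 2) * ‖G p‖)
    (c := fun n => 1 / ((n : ℝ) + 1) ^ 2)
    (fun n => by
      have := G.continuous.measurable
      exact Measurable.aestronglyMeasurable (by fun_prop))
    (fun p => by
      have h := ((hasSum_harmonicShift (ha p)).mul_left (‖p‖ ^ 2 * (‖p‖ ^ 2 + 6 * Λ ^ 2)))
      exact (Complex.hasSum_ofReal.mpr h).mul_right (G p))
    (fun n p => by
      have h1 := harmonic_term_nonneg (ha p) n
      have h2 := harmonic_term_le (ha p) n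
      have h3 : 0 ≤ ‖p‖ ^ 2 * (‖p‖ ^ 2 + 6 * Λ ^ 2) := by positivity
      rw [norm_mul, Complex.norm_real, Real.norm_eq_abs, abs_of_nonneg (mul_nonneg h3 h1),
        ← mul_assoc]
      refine mul_le_mul_of_nonneg_right ((mul_le_mul_of_nonneg_left h2 h3).trans_eq ?_)
        (norm_nonneg _)
      simp only [Polynomial.eval_mul, Polynomial.eval_add, Polynomial.eval_X, Polynomial.eval_C,
        Polynomial.eval_one]
      ring)
    (integrable_eval_norm_mul G _) summable_one_div_succ_sq
  obtain ⟨r, hr, hr0⟩ := exists_pos_forall_norm_lt hF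
  have hF0 : F 0 = 0 := hF.eq_of_nhds
  -- `F` lives in `‖x‖ ≥ r` and the terms decrease in `‖x‖`, so their values at `r` dominate.
  obtain ⟨hpi, hps⟩ := integrable_and_hasSum_integral (ν := (volume : Measure R4))
    (F := fun n x => ((seriesTerm Λ ‖x‖ n : ℝ) : ℂ) * F x)
    (S := fun x => ((∑' n, seriesTerm Λ ‖x‖ n : ℝ) : ℂ) * F x)
    (b := fun x => ‖F x‖) (c := seriesTerm Λ r)
    (fun n => (Complex.measurable_ofReal.comp ((measurable_seriesTerm Λ n).comp
      measurable_norm)).aestronglyMeasurable.mul F.continuous.aestronglyMeasurable)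
    (fun x => by
      rcases eq_or_ne x 0 with rfl | hx
      · simp [hF0]
      · exact (Complex.hasSum_ofReal.mpr
          (summable_seriesTerm hΛ (norm_pos_iff.mpr hx)).hasSum).mul_right _)
    (fun n x => norm_kernel_mul_le (k := fun y => seriesTerm Λ y n) hr hr0
      (fun y hy => seriesTerm_nonneg hΛ hy n) (fun y hy => seriesTerm_anti hΛ hr hy n) x)
    F.integrable.norm (summable_seriesTerm hΛ hr)
  have e1 : ∀ p : R4, ((nonlocalResponse Λ (‖p‖ ^ 2) : ℝ) : ℂ) * G p =
      ((1 / 8 : ℝ) : ℂ) * (((‖p‖ ^ 2 * (‖p‖ ^ 2 + 6 * Λ ^ 2) *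
        harmonicShift (‖p‖ ^ 2 / (6 * Λ ^ 2)) : ℝ) : ℂ) * G p) := fun p => by
    rw [nonlocalResponse, Complex.ofReal_mul, mul_assoc]
  have e2 : ∀ x : R4, ((positionSpace Λ ‖x‖ : ℝ) : ℂ) * F x =
      ((-(Real.pi ^ 2 / 2) * (6 * Λ ^ 2) ^ 4 : ℝ) : ℂ) *
        (((∑' n, seriesTerm Λ ‖x‖ n : ℝ) : ℂ) * F x) := fun x => by
    rw [positionSpace, Complex.ofReal_mul, mul_assoc]
  simp only [e1, e2]
  refine ⟨hmi.const_mul _, hpi.const_mul _, ?_⟩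
  rw [integral_const_mul, integral_const_mul]
  simp only [hG, integral_spectral_term hF hΛ] at hms
  rw [hms.unique (hps.mul_left _), ← mul_assoc, ← Complex.ofReal_mul]
  congr 2
  ring

open Polynomial in
/-- The local part of the renormalized response function. -/
def localResponse (Λ μ : ℝ) : ℝ[X] :=
  C (1 / 2) * X * (C (-2 * Λ ^ 2) + C (3 * Λ ^ 2 / 2) * (C (1 / (6 * Λ ^ 2)) * X + 1) *
    C (Real.log (3 * Λ ^ 2 / 2 / μ ^ 2) - kummerConst))

/-- All dependence on `μ` and on `kummerConst` is polynomial in `s`, hence invisible away from `x =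
0`. -/
lemma mul_renormalizedResponse {L Λ : ℝ} (hL : 0 < L) (hΛ : 0 < Λ) (μ s : ℝ) :
    L * renormalizedResponse L Λ μ s = (localResponse Λ μ).eval s + nonlocalResponse Λ s := by
  simp only [renormalizedResponse, localResponse, nonlocalResponse, Polynomial.eval_mul,
    Polynomial.eval_add, Polynomial.eval_X, Polynomial.eval_C, Polynomial.eval_one]
  field_simp
  ring

lemma fourierEqUpToContact_renormalizedResponse {L Λ : ℝ} (hL : 0 < L) (hΛ : 0 < Λ) (μ : ℝ)
    (Q : Polynomial ℝ) :
    FourierEqUpToContact (fun s => L * renormalizedResponse L Λ μ s + Q.eval s)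
      (positionSpace Λ) := by
  intro f hf hfc hf0
  set F : 𝓢(R4, ℂ) := hfc.toSchwartzMap hf with hFdef
  have hFf : ∀ x, F x = f x := fun x => rfl
  have hF : (F : R4 → ℂ) =ᶠ[𝓝 0] 0 := notMem_tsupport_iff_eventuallyEq.mp hf0
  obtain ⟨h1, h2, h3⟩ := nonlocalResponse_mul_angularFourier hF hΛ
  have e : ∀ p : R4, ((L * renormalizedResponse L Λ μ (‖p‖ ^ 2) + Q.eval (‖p‖ ^ 2) : ℝ) : ℂ) *
      ∫ x : R4, Complex.exp (Complex.I * ((inner ℝ p x : ℝ) : ℂ)) * f x =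
      (((localResponse Λ μ + Q).eval (‖p‖ ^ 2) : ℝ) : ℂ) * angularFourier F p +
        ((nonlocalResponse Λ (‖p‖ ^ 2) : ℝ) : ℂ) * angularFourier F p := by
    intro p
    rw [angularFourier_apply, mul_renormalizedResponse hL hΛ, Polynomial.eval_add]
    simp only [hFf]
    push_cast
    ring
  have hP := integrable_eval_mul (angularFourier F) (localResponse Λ μ + Q)
  simp only [e]
  refine ⟨hP.add h1, h2, ?_⟩
  rw [integral_add hP h1, integral_eval_mul_angularFourier hF, zero_add, h3]
  simp only [hFf]

end IHQCD

end

theorem mainTheorem4 :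
    (∀ L Λ μ : ℝ, 0 < L → 0 < Λ → 0 < μ →
      ∃ Ehat : ℝ → ℝ,
        (∀ s : ℝ, 0 ≤ s → ∀ e : ℝ, IHQCD.IsRenormalizedResponse L Λ μ s e ↔ e = Ehat s) ∧
        (∀ Q : Polynomial ℝ,
          IHQCD.FourierEqUpToContact (fun s => L * Ehat s + Q.eval s)
            (IHQCD.positionSpace Λ))) ∧
    (∀ Λ x : ℝ, 0 < Λ → 0 < x → Summable (IHQCD.seriesTerm Λ x)) ∧
    (∀ ε : ℝ, 0 < ε → ∃ R : ℝ, 0 < R ∧ ∀ Λ x : ℝ, 0 < Λ → R ≤ Λ * x →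
      |IHQCD.positionSpace Λ x - IHQCD.largeDistance Λ x| ≤
        ε * |IHQCD.largeDistance Λ x|) :=
  ⟨fun L Λ μ hL hΛ hμ => ⟨IHQCD.renormalizedResponse L Λ μ,
    fun _ hs _ => IHQCD.isRenormalizedResponse_iff hL hΛ hμ hs,
    fun Q => IHQCD.fourierEqUpToContact_renormalizedResponse hL hΛ μ Q⟩,
   fun _ _ hΛ hx => IHQCD.summable_seriesTerm hΛ hx,
   fun _ hε => IHQCD.positionSpace_asymptotics hε⟩
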